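/- Let $\mathbb U=\{z\in\mathbb C:|z|<1\}$ and let $d^2z$ be Lebesgue measure. For $n\in\mathbb Z$ and $k\in\{1,2,\dots\}$ let $j_{n,k}$ be the $k$-th positive zero of the Bessel function $J_{|n|}$ of the first kind, and let $$e_{n,k}(re^{i\phi})=\frac{1}{\sqrt\pi\,J_{|n|+1}(j_{n,k})}\,J_{|n|}(j_{n,k}r)\,e^{in\phi}$$ be the $L^2(\mathbb U)$-normalized Dirichlet eigenfunctions of the Laplacian on $\mathbb U$. For $s\in\mathbb R$ let $\mathcal H^s$ be the space of series $\sum_{n,k}a_{n,k}e_{n,k}$ with $\|a\|_s^2=\sum_{n,k}|a_{n,k}|^2j_{n,k}^{2s}<\infty$. For $s>0$ the elements of $\mathcal H^s$ are functions in $L^2(\mathbb U)$ (the series converges unconditionally there), and $\sum\alpha_{n,k}e_{n,k}\in\mathcal H^{-s}$ acts on $f=\sum a_{n,k}e_{n,k}\in\mathcal H^s$ by $\sum_{n,k}\alpha_{n,k}a_{-n,k}$. A function $g\in L^2(\mathbb U)$ is viewed as the functional $f\mapsto\int_{\mathbb U}g(z)f(z)\,d^2z$ on $\mathcal H^s$.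 Let $s>0$ and $w\in\mathbb C$. Then $z\mapsto\log|z-w|$ lies in $L^2(\mathbb U)$, is an element of $\mathcal H^{-s}$, and equals $\sum_{n\in\mathbb Z,\,k\ge1}\alpha_{n,k}(w)e_{n,k}$ in $\mathcal H^{-s}$, where $\alpha_{n,k}(w)=\int_{\mathbb U}\log|z-w|\,\overline{e_{n,k}(z)}\,d^2z$. That is: $\sum_{n,k}|\alpha_{n,k}(w)|^2j_{n,k}^{-2s}<\infty$; for every $f=\sum a_{n,k}e_{n,k}\in\mathcal H^s$ the function $z\mapsto\log|z-w|\,f(z)$ is integrable on $\mathbb U$ and $$\int_{\mathbb U}\log|z-w|\,f(z)\,d^2z=\sum_{n,k}\alpha_{n,k}(w)\,a_{-n,k};$$ and the finite partial sums of $\sum\alpha_{n,k}(w)e_{n,k}$ converge to $\log|\cdot-w|$ in the norm of the dual of $\mathcal H^s$. Moreover, for all $n\in\mathbb Z$ and $k\ge1$: if $|w|<1$, then $$\alpha_{n,k}(w)=-\frac{2\pi}{j_{n,k}^2}e_{-n,k}(w)-\mathbf 1(n>0)\frac{\sqrt\pi\,\overline w^{\,n}}{j_{n,k}|n|}-\mathbf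 1(n<0)\frac{\sqrt\pi\,w^{-n}}{j_{n,k}|n|},$$ and if $|w|\ge1$, then $$\alpha_{n,k}(w)=\frac{2\sqrt\pi}{j_{n,k}}\left(\delta_{n,0}\log|w|-\mathbf 1(n>0)\frac{1}{2n\,w^{n}}-\mathbf 1(n<0)\frac{1}{2|n|\,\overline w^{\,|n|}}\right),$$ where a term whose indicator vanishes is read as $0$. -/

import Mathlib

open MeasureTheory Filter Topology
open scoped ComplexConjugate

noncomputable section

/-- The Bessel function of the first kind `J_n` of order `n = 0, 1, 2, …` on the real line. -/
def besselJ (n : ℕ) (x : ℝ) : ℝ :=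
  ∑' m : ℕ, (-1) ^ m / ((m.factorial : ℝ) * ((m + n).factorial : ℝ)) * (x / 2) ^ (2 * m + n)

/-- `besselZero n k`, for `k ≥ 1`, is the `k`-th positive zero of `J_n`: starting from `0`,
each step moves to the next zero to the right. -/
def besselZero (n : ℕ) : ℕ → ℝ
  | 0 => 0
  | k + 1 => sInf {x : ℝ | besselZero n k < x ∧ besselJ n x = 0}

/-- `j_{|n|,k}` for `n ∈ ℤ` and `k ∈ {1, 2, …}`. -/
def jz (n : ℤ) (k : ℕ+) : ℝ := besselZero n.natAbs k

/-- Lebesgue measure on the open unit disk. -/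
def diskMeasure : Measure ℂ := (volume : Measure ℂ).restrict (Metric.ball 0 1)

/-- The normalized Dirichlet eigenfunction
`e_{n,k}(r e^{iφ}) = C_{n,k} J_{|n|}(j_{|n|,k} r) e^{inφ}`,
with `C_{n,k} = 1 / (√π J_{|n|+1}(j_{|n|,k}))`. -/
def eigenfn (n : ℤ) (k : ℕ+) (z : ℂ) : ℂ :=
  ((1 / √Real.pi * (1 / besselJ (n.natAbs + 1) (jz n k)) * besselJ n.natAbs (jz n k * ‖z‖) : ℝ) : ℂ)
    * Complex.exp (Complex.I * (n : ℂ) * (Complex.arg z : ℂ))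

/-- The Fourier–Bessel coefficient `∫_{|z|<1} g(z) conj(e_{n,k}(z)) d²z`. -/
def fourierBesselCoeff (g : ℂ → ℂ) (n : ℤ) (k : ℕ+) : ℂ :=
  ∫ z, g z * conj (eigenfn n k z) ∂diskMeasure

/-- The coefficient array `a` defines an element `∑ a_{n,k} e_{n,k}` of `H^s`. -/
def MemH (s : ℝ) (a : ℤ × ℕ+ → ℂ) : Prop :=
  Summable fun p : ℤ × ℕ+ => ‖a p‖ ^ 2 * jz p.1 p.2 ^ (2 * s)

/-- The norm of `∑ a_{n,k} e_{n,k}` in `H^s`. -/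
def hNorm (s : ℝ) (a : ℤ × ℕ+ → ℂ) : ℝ :=
  √(∑' p : ℤ × ℕ+, ‖a p‖ ^ 2 * jz p.1 p.2 ^ (2 * s))

/-- The function `∑_{(n,k) ∈ F} a_{n,k} e_{n,k}`. -/
def partialSum (a : ℤ × ℕ+ → ℂ) (F : Finset (ℤ × ℕ+)) (z : ℂ) : ℂ :=
  ∑ p ∈ F, a p * eigenfn p.1 p.2 z

/-- `f` is in `L²` of the disk and is there the unconditional sum of `∑ a_{n,k} e_{n,k}`.
This is how an element of `H^s`, `s ≥ 0`, is a function. -/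
def IsL2Sum (a : ℤ × ℕ+ → ℂ) (f : ℂ → ℂ) : Prop :=
  MemLp f 2 diskMeasure ∧
    Tendsto (fun F : Finset (ℤ × ℕ+) => eLpNorm (fun z => f z - partialSum a F z) 2 diskMeasure)
      atTop (𝓝 0)

/-- The function `g`, viewed as the generalized function `f ↦ ∫_{|z|<1} g f d²z` acting on
`f ∈ H^s` (`s > 0`), is an element of `H^{-s}` and equals `∑ α_{n,k} e_{n,k}` there. -/
structure EqualsInHNeg (s : ℝ) (g : ℂ → ℂ) (α : ℤ × ℕ+ → ℂ) : Prop where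
  /-- `∑ α_{n,k} e_{n,k}` is an element of `H^{-s}`. -/
  memH : MemH (-s) α
  /-- Every element of `H^s` is a function in `L²`. -/
  exists_l2Sum : ∀ a : ℤ × ℕ+ → ℂ, MemH s a → ∃ f : ℂ → ℂ, IsL2Sum a f
  /-- For `f = ∑ a_{n,k} e_{n,k}` in `H^s`, the action of `g` on `f` is
  `∑ α_{n,k} a_{-n,k}`. -/
  action : ∀ (a : ℤ × ℕ+ → ℂ) (f : ℂ → ℂ), MemH s a → IsL2Sum a f →
    Integrable (fun z => g z * f z) diskMeasure ∧
      HasSum (fun p : ℤ × ℕ+ => α p * a (-p.1, p.2)) (∫ z, g z * f z ∂diskMeasure)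
  /-- The partial sums of `∑ α_{n,k} e_{n,k}` converge to `g` in the norm of the dual
  of `H^s`. -/
  tendsto : ∀ ε : ℝ, 0 < ε → ∀ᶠ F : Finset (ℤ × ℕ+) in atTop,
    ∀ (a : ℤ × ℕ+ → ℂ) (f : ℂ → ℂ), MemH s a → IsL2Sum a f →
      ‖∫ z, (g z - partialSum α F z) * f z ∂diskMeasure‖ ≤ ε * hNorm s a

/-- The function `z ↦ log |z - w|`. -/
def logDist (w : ℂ) (z : ℂ) : ℂ := (Real.log ‖z - w‖ : ℂ)

end

/-!
The statement splits into an abstract part, which holds for every `g ∈ L²` of the disk, and the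
evaluation of the coefficients of `log |z - w|`.

*Abstract part* (`equalsInHNeg_of_memLp`). The functions `e_{n,k}` are orthonormal in `L²` of the
disk (`orthonormal_eigenLp`) and all `j_{n,k}` exceed `1` (`one_lt_jz`), so that `ℓ²` coefficients
embed into those of `H^{-s}`, and those of `H^s` into `ℓ²`. For `f = ∑ a_{n,k} e_{n,k}` the identity
`∫ g f = ∑ α_{n,k} a_{-n,k}` is the continuity of the inner product
(`IsL2Sum.hasSum_integral_mul`), and the convergence of the partial sums in the dual norm is the
Cauchy–Schwarz inequality (`norm_tsum_mul_le`) together with the vanishing of the tails of a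
convergent series. Completeness of the eigenfunctions plays no role: the functional is only tested
on sums of eigenfunctions.

*Bessel functions.* Writing `J_n(x) = (x/2)^n h_n(x²/4)` with `h_n` entire, everything rests on
`h_n' = -h_{n+1}` and `h_n = (n+1) h_{n+1} - t h_{n+2}`. Orthogonality and norms of the radial
functions come from explicit antiderivatives (`integral_besselJ_mul_besselJ`,
`integral_mul_besselJ_sq`); the latter also shows that positive zeros are simple. There are
infinitely many zeros by Sturm comparison for `J_0` and by Rolle's theorem from `J_n` to `J_{n+1}`.

*Coefficients.* On the circle of radius `r` the expansion
`log |1 - q e^{iθ}| = -Re ∑ q^m e^{imθ} / m` gives the angular Fourier coefficients of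
`log |z - w|`: multiples of `(r/w)^n` for `r < |w|` and of `(w̄/r)^n` for `r > |w|`. The remaining radial
integrals of `r^{n+1} J_n(jr)` and `r^{1-n} J_n(jr)` (with a logarithm if `n = 0`) have antiderivatives in
terms of `J_{n+1}`, `J_{n-1}`, and for `|w| < 1` the two pieces combine through the three-term
recurrence. Negative `n` follows by complex conjugation.
-/

/-! ### Bessel functions of integer order -/

/-- The entire function `h_n(t) = ∑ (-1)^m t^m / (m! (m+n)!)`, restricted to the real line. It
satisfies `J_n(x) = (x/2)^n h_n(x²/4)`, which turns the identities for `J_n` into identities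
without negative powers of `x`. -/
noncomputable def besselAux (n : ℕ) (t : ℝ) : ℝ :=
  ∑' m : ℕ, (-1) ^ m / ((m.factorial : ℝ) * ((m + n).factorial : ℝ)) * t ^ m

theorem norm_besselAux_term_le (n m : ℕ) (t : ℝ) :
    ‖(-1) ^ m / ((m.factorial : ℝ) * ((m + n).factorial : ℝ)) * t ^ m‖ ≤
      |t| ^ m / m.factorial := by
  have h1 : (1 : ℝ) ≤ (m + n).factorial := by
    exact_mod_cast Nat.succ_le_of_lt (Nat.factorial_pos _)
  have h2 : (0 : ℝ) < m.factorial := by exact_mod_cast Nat.factorial_pos _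
  rw [norm_mul, norm_div, norm_pow, norm_neg, norm_one, one_pow, norm_pow, Real.norm_eq_abs,
    Real.norm_eq_abs, abs_of_pos (by positivity), div_mul_eq_mul_div, one_mul]
  gcongr
  nlinarith

theorem summable_besselAux (n : ℕ) (t : ℝ) :
    Summable fun m : ℕ => (-1) ^ m / ((m.factorial : ℝ) * ((m + n).factorial : ℝ)) * t ^ m :=
  .of_norm_bounded (Real.summable_pow_div_factorial |t|) fun m => norm_besselAux_term_le n m t

theorem besselJ_eq (n : ℕ) (x : ℝ) : besselJ n x = (x / 2) ^ n * besselAux n (x ^ 2 / 4) := by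
  rw [besselJ, besselAux, ← tsum_mul_left]
  refine tsum_congr fun m => ?_
  rw [pow_add, pow_mul, show (x / 2) ^ 2 = x ^ 2 / 4 by ring]
  ring

theorem hasDerivAt_besselAux (n : ℕ) (t : ℝ) :
    HasDerivAt (besselAux n) (-besselAux (n + 1) t) t := by
  set R : ℝ := |t| + 1
  have hR : 0 ≤ R := by positivity
  have hu : Summable fun m : ℕ => (m : ℝ) * R ^ (m - 1) / m.factorial := by
    rw [← summable_nat_add_iff 1]
    refine (Real.summable_pow_div_factorial R).congr fun m => ?_
    rw [Nat.factorial_succ, Nat.add_sub_cancel]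
    push_cast
    field_simp
  have key := hasDerivAt_tsum_of_isPreconnected (t := Metric.ball (0 : ℝ) R) (y₀ := 0)
    (g := fun (m : ℕ) y => (-1) ^ m / ((m.factorial : ℝ) * ((m + n).factorial : ℝ)) * y ^ m)
    (g' := fun (m : ℕ) y =>
      (-1) ^ m / ((m.factorial : ℝ) * ((m + n).factorial : ℝ)) * ((m : ℝ) * y ^ (m - 1)))
    (y := t) hu Metric.isOpen_ball
    (convex_ball (0 : ℝ) R).isPreconnected
    (fun m y _ => (hasDerivAt_pow m y).const_mul _) ?_ (by simp [R]; positivity)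
    (summable_besselAux n 0) (by simp [R])
  · refine key.congr_deriv ?_
    have hs : Summable fun m : ℕ => (-1) ^ m / ((m.factorial : ℝ) * ((m + n).factorial : ℝ)) *
        ((m : ℝ) * t ^ (m - 1)) := by
      rw [← summable_nat_add_iff 1]
      refine (summable_besselAux (n + 1) t).neg.congr fun m => ?_
      rw [Nat.factorial_succ, Nat.add_sub_cancel, pow_succ, show m + 1 + n = m + (n + 1) by ring]
      push_cast
      field_simp
    rw [hs.tsum_eq_zero_add, besselAux, ← tsum_neg]
    simp only [Nat.cast_zero, zero_mul, mul_zero, zero_add]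
    refine tsum_congr fun m => ?_
    rw [Nat.factorial_succ, Nat.add_sub_cancel, pow_succ, show m + 1 + n = m + (n + 1) by ring]
    push_cast
    field_simp
  · intro m y hy
    have h1 : (1 : ℝ) ≤ (m + n).factorial := by
      exact_mod_cast Nat.succ_le_of_lt (Nat.factorial_pos _)
    have h2 : (0 : ℝ) < m.factorial := by exact_mod_cast Nat.factorial_pos _
    have h3 : |y| ≤ R := by simpa using (Metric.mem_ball.1 hy).le
    rw [norm_mul, norm_div, norm_pow, norm_neg, norm_one, one_pow, norm_mul (m : ℝ), norm_pow,
      Real.norm_eq_abs, Real.norm_eq_abs, Real.norm_eq_abs, abs_of_pos (by positivity),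
      Nat.abs_cast, div_mul_eq_mul_div, one_mul]
    gcongr
    nlinarith

theorem besselAux_rec (n : ℕ) (t : ℝ) :
    besselAux n t = (n + 1) * besselAux (n + 1) t - t * besselAux (n + 2) t := by
  have h2 : Summable fun m : ℕ => (m : ℝ) *
      ((-1) ^ m / ((m.factorial : ℝ) * ((m + (n + 1)).factorial : ℝ)) * t ^ m) := by
    rw [← summable_nat_add_iff 1]
    refine ((summable_besselAux (n + 2) t).mul_left (-t)).congr fun m => ?_
    rw [Nat.factorial_succ, pow_succ, pow_succ, show m + 1 + (n + 1) = m + (n + 2) by ring]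
    push_cast
    field_simp
  have h3 : t * besselAux (n + 2) t = -∑' m : ℕ, (m : ℝ) *
      ((-1) ^ m / ((m.factorial : ℝ) * ((m + (n + 1)).factorial : ℝ)) * t ^ m) := by
    rw [h2.tsum_eq_zero_add, besselAux, ← tsum_mul_left]
    simp only [Nat.cast_zero, zero_mul, zero_add]
    rw [← tsum_neg]
    refine tsum_congr fun m => ?_
    rw [Nat.factorial_succ, pow_succ, pow_succ, show m + 1 + (n + 1) = m + (n + 2) by ring]
    push_cast
    field_simp
  rw [h3, sub_neg_eq_add, besselAux, besselAux, ← tsum_mul_left,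
    ← ((summable_besselAux (n + 1) t).mul_left _).tsum_add h2]
  refine tsum_congr fun m => ?_
  rw [show m + (n + 1) = m + n + 1 by ring, Nat.factorial_succ]
  push_cast
  field_simp
  ring

theorem besselAux_pos (n : ℕ) {t : ℝ} (h0 : 0 ≤ t) (h1 : t ≤ 1 / 4) : 0 < besselAux n t := by
  have hn : (0 : ℝ) < n.factorial := by exact_mod_cast Nat.factorial_pos _
  have hg : HasSum (fun m : ℕ => 1 / (n.factorial : ℝ) * ((1 / 4) ^ m * (1 / 4)))
      (1 / (n.factorial : ℝ) * (1 / 3)) := by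
    have h := ((hasSum_geometric_of_lt_one (r := (1 / 4 : ℝ)) (by norm_num)
      (by norm_num)).mul_right (1 / 4)).mul_left (1 / (n.factorial : ℝ))
    rwa [show (1 - 1 / 4 : ℝ)⁻¹ * (1 / 4) = 1 / 3 by norm_num] at h
  have hb := tsum_of_norm_bounded (f := fun m : ℕ => (-1) ^ (m + 1) /
    (((m + 1).factorial : ℝ) * ((m + 1 + n).factorial : ℝ)) * t ^ (m + 1)) hg ?_
  · rw [besselAux, (summable_besselAux n t).tsum_eq_zero_add]
    simp only [pow_zero, Nat.factorial_zero, Nat.cast_one, one_mul, zero_add, mul_one]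
    have := (abs_le.1 hb).1
    have : 0 < 1 / (n.factorial : ℝ) := by positivity
    linarith
  · intro m
    have e1 : (1 : ℝ) ≤ (m + 1).factorial := by
      exact_mod_cast Nat.succ_le_of_lt (Nat.factorial_pos _)
    have e2 : (n.factorial : ℝ) ≤ (m + 1 + n).factorial := by
      exact_mod_cast Nat.factorial_le (by omega)
    rw [norm_mul, norm_div, norm_pow, norm_neg, norm_one, one_pow, norm_pow, Real.norm_eq_abs,
      Real.norm_eq_abs, abs_of_pos (by positivity), abs_of_nonneg h0, ← pow_succ]
    gcongr
    nlinarith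

/-- Below `1` the first term of the series dominates; in particular all positive zeros of all `J_n`
exceed `1`. -/
theorem besselJ_pos (n : ℕ) {x : ℝ} (h0 : 0 < x) (h1 : x ≤ 1) : 0 < besselJ n x := by
  rw [besselJ_eq]
  exact mul_pos (by positivity) (besselAux_pos n (by positivity) (by nlinarith))

theorem continuous_besselAux (n : ℕ) : Continuous (besselAux n) :=
  continuous_iff_continuousAt.2 fun t => (hasDerivAt_besselAux n t).continuousAt

@[fun_prop]
theorem continuous_besselJ (n : ℕ) : Continuous (besselJ n) := by
  rw [show besselJ n = fun x => (x / 2) ^ n * besselAux n (x ^ 2 / 4) from funext (besselJ_eq n)]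
  have := continuous_besselAux n
  fun_prop

theorem hasDerivAt_besselAux_sq (n : ℕ) (x : ℝ) :
    HasDerivAt (fun y => besselAux n (y ^ 2 / 4)) (-(x / 2) * besselAux (n + 1) (x ^ 2 / 4)) x := by
  have h : HasDerivAt (fun y : ℝ => y ^ 2 / 4) (x / 2) x := by
    refine ((hasDerivAt_pow 2 x).div_const 4).congr_deriv ?_
    norm_num
    ring
  refine ((hasDerivAt_besselAux n (x ^ 2 / 4)).comp x h).congr_deriv ?_
  ring

theorem hasDerivAt_besselJ_zero (x : ℝ) : HasDerivAt (besselJ 0) (-besselJ 1 x) x := by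
  rw [show besselJ 0 = fun y => besselAux 0 (y ^ 2 / 4) from funext fun y => by simp [besselJ_eq]]
  refine (hasDerivAt_besselAux_sq 0 x).congr_deriv ?_
  rw [besselJ_eq]
  ring

/-- Stated without division by `x`, so that it holds at `x = 0` too. -/
theorem hasDerivAt_pow_mul_besselJ (n : ℕ) (x : ℝ) :
    HasDerivAt (fun y => y ^ (n + 1) * besselJ (n + 1) y) (x ^ (n + 1) * besselJ n x) x := by
  have h := ((hasDerivAt_pow (n + 1) x).fun_mul
    ((((hasDerivAt_id x).div_const 2).fun_pow (n + 1)).fun_mul (hasDerivAt_besselAux_sq (n + 1) x)))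
  refine (h.congr_deriv ?_).congr_of_eventuallyEq (Eventually.of_forall fun y => ?_)
  · rw [besselJ_eq, besselAux_rec n]
    simp only [id, Nat.add_sub_cancel, div_pow, pow_succ]
    push_cast
    field_simp
    ring
  · simp [besselJ_eq]

theorem besselJ_rec (n : ℕ) (x : ℝ) :
    2 * (n + 1) * besselJ (n + 1) x = x * (besselJ n x + besselJ (n + 2) x) := by
  rw [besselJ_eq, besselJ_eq, besselJ_eq, besselAux_rec n]
  simp only [div_pow, pow_succ]
  field_simp
  ring

theorem hasDerivAt_besselJ (n : ℕ) {x : ℝ} (hx : x ≠ 0) :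
    HasDerivAt (besselJ n) (n / x * besselJ n x - besselJ (n + 1) x) x := by
  have h := (((hasDerivAt_id x).div_const 2).fun_pow n).fun_mul (hasDerivAt_besselAux_sq n x)
  refine (h.congr_deriv ?_).congr_of_eventuallyEq (Eventually.of_forall fun y => ?_)
  · rw [besselJ_eq, besselJ_eq]
    rcases n with _ | n
    · simp
    · simp only [id, Nat.add_sub_cancel, div_pow, pow_succ]
      push_cast
      field_simp
      ring
  · simp [besselJ_eq]

theorem hasDerivAt_besselJ_succ (n : ℕ) {x : ℝ} (hx : x ≠ 0) :
    HasDerivAt (besselJ (n + 1)) (besselJ n x - (n + 1) / x * besselJ (n + 1) x) x := by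
  refine (hasDerivAt_besselJ (n + 1) hx).congr_deriv ?_
  have := besselJ_rec n x
  push_cast
  field_simp
  linarith

/-- Lommel's integral: at a zero of `J_n` it gives the norm of the eigenfunctions. -/
theorem integral_mul_besselJ_sq (n : ℕ) {b : ℝ} (hb : 0 ≤ b) :
    ∫ x in (0 : ℝ)..b, 2 * x * besselJ n x ^ 2 =
      b ^ 2 * (besselJ n b ^ 2 + besselJ (n + 1) b ^ 2)
        - 2 * n * b * besselJ n b * besselJ (n + 1) b := by
  rw [intervalIntegral.integral_eq_sub_of_hasDerivAt_of_le (f := fun x =>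
    x ^ 2 * (besselJ n x ^ 2 + besselJ (n + 1) x ^ 2) - 2 * n * x * besselJ n x * besselJ (n + 1) x)
    hb (by fun_prop) ?_ (Continuous.intervalIntegrable (by fun_prop) _ _)]
  · simp
  · intro x hx
    have hx0 := hx.1.ne'
    have h1 := hasDerivAt_besselJ n hx0
    have h2 := hasDerivAt_besselJ_succ n hx0
    refine (((hasDerivAt_pow 2 x).fun_mul ((h1.fun_pow 2).fun_add (h2.fun_pow 2))).fun_sub
      ((((hasDerivAt_id x).const_mul (2 * n : ℝ)).fun_mul h1).fun_mul h2)).congr_deriv ?_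
    simp only [id, Nat.cast_ofNat, Nat.add_one_sub_one, pow_one]
    field_simp
    ring

/-- Positive zeros of `J_n` are simple: otherwise the integral of `2 x J_n(x)²` up to the zero would
vanish. -/
theorem besselJ_succ_ne_zero (n : ℕ) {b : ℝ} (hb : 0 < b) (h : besselJ n b = 0) :
    besselJ (n + 1) b ≠ 0 := by
  intro h'
  have e := integral_mul_besselJ_sq n hb.le
  rw [h, h'] at e
  have : 0 < ∫ x in (0 : ℝ)..b, 2 * x * besselJ n x ^ 2 := by
    refine intervalIntegral.integral_pos hb (by fun_prop) (fun x hx => ?_)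
      ⟨min b 1, ⟨by positivity, min_le_left _ _⟩, ?_⟩
    · have := hx.1
      positivity
    · have := besselJ_pos n (x := min b 1) (by positivity) (min_le_right _ _)
      positivity
  rw [e] at this
  simp at this

/-- Orthogonality of `r ↦ J_n(ar)` and `r ↦ J_n(br)` for zeros `a ≠ b` of `J_n`. -/
theorem integral_besselJ_mul_besselJ (n : ℕ) {a b : ℝ} (ha : 0 < a) (hb : 0 < b) (hab : a ≠ b)
    (hJa : besselJ n a = 0) (hJb : besselJ n b = 0) :
    ∫ r in (0 : ℝ)..1, r * (besselJ n (a * r) * besselJ n (b * r)) = 0 := by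
  have key : ∫ r in (0 : ℝ)..1, (a ^ 2 - b ^ 2) * (r * (besselJ n (a * r) * besselJ n (b * r)))
      = 0 := by
    rw [intervalIntegral.integral_eq_sub_of_hasDerivAt_of_le (f := fun r =>
      r * (a * (besselJ (n + 1) (a * r) * besselJ n (b * r))
        - b * (besselJ n (a * r) * besselJ (n + 1) (b * r))))
      zero_le_one (by fun_prop) ?_ (Continuous.intervalIntegrable (by fun_prop) _ _)]
    · simp [hJa, hJb]
    · intro r hr
      have hr0 := hr.1.ne'
      have lin (c : ℝ) : HasDerivAt (fun r => c * r) c r := by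
        simpa using (hasDerivAt_id r).const_mul c
      have a1 := (hasDerivAt_besselJ n (mul_ne_zero ha.ne' hr0)).comp r (lin a)
      have a2 := (hasDerivAt_besselJ_succ n (mul_ne_zero ha.ne' hr0)).comp r (lin a)
      have b1 := (hasDerivAt_besselJ n (mul_ne_zero hb.ne' hr0)).comp r (lin b)
      have b2 := (hasDerivAt_besselJ_succ n (mul_ne_zero hb.ne' hr0)).comp r (lin b)
      refine ((hasDerivAt_id r).fun_mul (((a2.fun_mul b1).const_mul a).fun_sub
        ((a1.fun_mul b2).const_mul b))).congr_deriv ?_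
      simp only [id, Function.comp]
      field_simp
      ring
  rw [intervalIntegral.integral_const_mul] at key
  refine (mul_eq_zero.1 key).resolve_left fun h => hab ?_
  nlinarith [mul_eq_zero.1 (show (a - b) * (a + b) = 0 by linarith)]

/-- The squared norm of `r ↦ J_n(ar)` with respect to `r dr`, at a zero `a` of `J_n`. -/
theorem integral_besselJ_mul_self (n : ℕ) {a : ℝ} (ha : 0 < a) (hJa : besselJ n a = 0) :
    ∫ r in (0 : ℝ)..1, r * (besselJ n (a * r) * besselJ n (a * r)) =
      besselJ (n + 1) a ^ 2 / 2 := by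
  have h := intervalIntegral.integral_comp_mul_left (fun x => 2 * x * besselJ n x ^ 2) ha.ne'
    (a := 0) (b := 1)
  rw [mul_zero, mul_one, integral_mul_besselJ_sq n ha.le, hJa] at h
  have h2 : ∫ r in (0 : ℝ)..1, 2 * (a * r) * besselJ n (a * r) ^ 2 =
      2 * a * ∫ r in (0 : ℝ)..1, r * (besselJ n (a * r) * besselJ n (a * r)) := by
    rw [← intervalIntegral.integral_const_mul]
    congr 1
    ext r
    ring
  rw [h2, smul_eq_mul, eq_inv_mul_iff_mul_eq₀ ha.ne'] at h
  have ha2 : a ^ 2 ≠ 0 := by positivity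
  refine mul_left_cancel₀ ha2 ?_
  linarith

/-! ### Positive zeros of Bessel functions -/

/-- Sturm comparison of `u = √x J_0(x)`, which solves `D²u + (1 + 1/(4x²)) u = 0`, with
`sin (x - a)`: if `u` has constant sign on `[a, a + π]`, then the Wronskian of the two functions is
monotone in the direction opposite to the one forced by its values at the endpoints. -/
theorem exists_besselJ_zero_eq_zero {a : ℝ} (ha : 0 < a) :
    ∃ x ∈ Set.Icc a (a + Real.pi), besselJ 0 x = 0 := by
  by_contra! hne
  obtain ⟨σ, hσ⟩ : ∃ σ : ℝ, ∀ x ∈ Set.Icc a (a + Real.pi), 0 < σ * besselJ 0 x := by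
    have hpi := Real.pi_pos
    have hca : a ∈ Set.Icc a (a + Real.pi) := ⟨le_rfl, by linarith⟩
    refine ⟨besselJ 0 a, fun x hx => ?_⟩
    by_contra! hle
    have : (0 : ℝ) ∈ (fun y => besselJ 0 a * besselJ 0 y) '' Set.Icc a x :=
      intermediate_value_Icc' hx.1 (by fun_prop) ⟨hle, mul_self_nonneg _⟩
    obtain ⟨y, hy, hy0⟩ := this
    exact (mul_ne_zero (hne a hca) (hne y ⟨hy.1, hy.2.trans hx.2⟩)) hy0
  -- the Wronskian of `√x J_0(x)` and `sin (x - a)`, multiplied by a constant `σ` with the sign of `J_0`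
  set W : ℝ → ℝ := fun x => σ * ((besselJ 0 x / (2 * √x) - √x * besselJ 1 x) * Real.sin (x - a)
    - √x * besselJ 0 x * Real.cos (x - a)) with hW
  have hder (x : ℝ) (hx : 0 < x) :
      HasDerivAt W (-(σ * besselJ 0 x) / (4 * x * √x) * Real.sin (x - a)) x := by
    have hs := Real.hasDerivAt_sqrt hx.ne'
    have h0 := hasDerivAt_besselJ_zero x
    have h1 := hasDerivAt_besselJ_succ 0 hx.ne'
    have hsin : HasDerivAt (fun x => Real.sin (x - a)) (Real.cos (x - a)) x := by
      simpa using ((hasDerivAt_id x).sub_const a).sin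
    have hcos : HasDerivAt (fun x => Real.cos (x - a)) (-Real.sin (x - a)) x := by
      simpa using ((hasDerivAt_id x).sub_const a).cos
    have hsp : 0 < √x := Real.sqrt_pos.2 hx
    refine (((((h0.fun_div (hs.const_mul 2) (by positivity)).fun_sub (hs.fun_mul h1)).fun_mul
      hsin).fun_sub ((hs.fun_mul h0).fun_mul hcos)).const_mul σ).congr_deriv ?_
    obtain ⟨q, hq⟩ : ∃ q, q = √x := ⟨_, rfl⟩
    have hxq : x = q ^ 2 := by rw [hq, Real.sq_sqrt hx.le]
    rw [← hq] at hsp ⊢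
    simp only [zero_add, Nat.cast_zero]
    generalize besselJ 0 x = A
    generalize besselJ 1 x = B
    generalize Real.sin (x - a) = S
    generalize Real.cos (x - a) = C
    rw [hxq]
    field_simp
    ring
  have hanti : AntitoneOn W (Set.Icc a (a + Real.pi)) := by
    refine antitoneOn_of_deriv_nonpos (convex_Icc _ _)
      (fun x hx => (hder x (ha.trans_le hx.1)).continuousAt.continuousWithinAt)
      (fun x hx => ?_) (fun x hx => ?_) <;> rw [interior_Icc] at hx
    · exact (hder x (ha.trans hx.1)).differentiableAt.differentiableWithinAt
    · have hx0 := ha.trans hx.1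
      rw [(hder x hx0).deriv, neg_div, neg_mul, neg_nonpos]
      have := hσ x ⟨hx.1.le, hx.2.le⟩
      have := Real.sin_nonneg_of_nonneg_of_le_pi (x := x - a) (by linarith [hx.1])
        (by linarith [hx.2])
      positivity
  have hpi := Real.pi_pos
  have ha1 := hσ a ⟨le_rfl, by linarith⟩
  have ha2 := hσ (a + Real.pi) ⟨by linarith, le_rfl⟩
  have hle := hanti ⟨le_rfl, by linarith⟩ ⟨by linarith, le_rfl⟩ (by linarith : a ≤ a + Real.pi)
  simp only [hW, sub_self, Real.sin_zero, Real.cos_zero, add_sub_cancel_left, Real.sin_pi,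
    Real.cos_pi] at hle
  have := mul_pos (Real.sqrt_pos.2 ha) ha1
  have := mul_pos (Real.sqrt_pos.2 (by linarith : 0 < a + Real.pi)) ha2
  linarith

/-- `J_n` has arbitrarily large zeros. -/
theorem exists_besselJ_eq_zero (n : ℕ) {a : ℝ} (ha : 0 < a) : ∃ x, a < x ∧ besselJ n x = 0 := by
  induction n generalizing a with
  | zero =>
    obtain ⟨x, hx, h0⟩ := exists_besselJ_zero_eq_zero (a := a + 1) (by linarith)
    exact ⟨x, by linarith [hx.1], h0⟩
  | succ n ih =>
    -- Rolle's theorem for `x^{-n} J_n(x)`, up to a constant factor, between zeros of `J_n`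
    obtain ⟨b, hb, hb0⟩ := ih ha
    obtain ⟨c, hc, hc0⟩ := ih (ha.trans hb)
    have hz {x : ℝ} (hx : 0 < x) (h : besselJ n x = 0) : besselAux n (x ^ 2 / 4) = 0 := by
      rw [besselJ_eq] at h
      exact (mul_eq_zero.1 h).resolve_left (by positivity)
    obtain ⟨x, hx, hx0⟩ := exists_hasDerivAt_eq_zero hc
      (fun x _ => (hasDerivAt_besselAux_sq n x).continuousAt.continuousWithinAt)
      ((hz (ha.trans hb) hb0).trans (hz (ha.trans (hb.trans hc)) hc0).symm)
      (fun x _ => hasDerivAt_besselAux_sq n x)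
    have hxp : 0 < x := ha.trans (hb.trans hx.1)
    refine ⟨x, hb.trans hx.1, ?_⟩
    rw [besselJ_eq, (mul_eq_zero.1 hx0).resolve_left (by linarith), mul_zero]

/-- If the zeros of `J_n` do not accumulate at `z` from the right, there is a next zero. -/
theorem sInf_besselJ_zeros_mem (n : ℕ) {z : ℝ} (hz : 0 ≤ z)
    (h : ∀ᶠ x in 𝓝[>] z, besselJ n x ≠ 0) :
    sInf {x : ℝ | z < x ∧ besselJ n x = 0} ∈ {x : ℝ | z < x ∧ besselJ n x = 0} := by
  obtain ⟨u, hu, hsub⟩ := mem_nhdsGT_iff_exists_Ioo_subset.1 h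
  have heq : {x : ℝ | z < x ∧ besselJ n x = 0} = Set.Ici u ∩ {x | besselJ n x = 0} := by
    ext x
    constructor
    · rintro ⟨h1, h2⟩
      refine ⟨?_, h2⟩
      by_contra hlt
      exact hsub ⟨h1, not_le.1 hlt⟩ h2
    · rintro ⟨h1, h2⟩
      exact ⟨lt_of_lt_of_le hu h1, h2⟩
  obtain ⟨x, hx, hx0⟩ := exists_besselJ_eq_zero n (a := z + 1) (by linarith)
  refine IsClosed.csInf_mem ?_ ⟨x, by linarith, hx0⟩ ⟨z, fun y hy => hy.1.le⟩
  rw [heq]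
  exact isClosed_Ici.inter (isClosed_eq (continuous_besselJ n) continuous_const)

/-- The infimum defining `besselZero` is never a junk value: it is attained at a zero of `J_n`. -/
theorem besselZero_nonneg_and_spec (n k : ℕ) : 0 ≤ besselZero n k ∧
    besselZero n k < besselZero n (k + 1) ∧ besselJ n (besselZero n (k + 1)) = 0 := by
  induction k with
  | zero =>
    refine ⟨le_rfl, sInf_besselJ_zeros_mem n (z := besselZero n 0) le_rfl ?_⟩
    filter_upwards [Ioc_mem_nhdsGT (show besselZero n 0 < 1 from zero_lt_one)] with x hx
    exact (besselJ_pos n hx.1 hx.2).ne'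
  | succ k ih =>
    have hpos := ih.1.trans_lt ih.2.1
    refine ⟨hpos.le, sInf_besselJ_zeros_mem n hpos.le ?_⟩
    -- positive zeros of `J_n` are simple, hence isolated
    have hd := hasDerivAt_besselJ n hpos.ne'
    rw [ih.2.2, mul_zero, zero_sub] at hd
    exact (hd.eventually_ne (neg_ne_zero.2 (besselJ_succ_ne_zero n hpos ih.2.2))).filter_mono
      (nhdsWithin_mono _ fun x hx => ne_of_gt hx)

theorem strictMono_besselZero (n : ℕ) : StrictMono (besselZero n) :=
  strictMono_nat_of_lt_succ fun k => (besselZero_nonneg_and_spec n k).2.1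

theorem besselJ_jz (n : ℤ) (k : ℕ+) : besselJ n.natAbs (jz n k) = 0 := by
  have h := (besselZero_nonneg_and_spec n.natAbs (k - 1 : ℕ)).2.2
  rwa [Nat.sub_add_cancel k.pos] at h

theorem jz_pos (n : ℤ) (k : ℕ+) : 0 < jz n k :=
  strictMono_besselZero n.natAbs k.pos

theorem one_lt_jz (n : ℤ) (k : ℕ+) : 1 < jz n k := by
  by_contra! h
  exact (besselJ_pos n.natAbs (jz_pos n k) h).ne' (besselJ_jz n k)

theorem jz_injective (n : ℤ) : Function.Injective (jz n) :=
  fun _ _ h => PNat.coe_injective ((strictMono_besselZero n.natAbs).injective h)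

theorem jz_neg (n : ℤ) (k : ℕ+) : jz (-n) k = jz n k := by
  rw [jz, jz, Int.natAbs_neg]

theorem besselJ_succ_jz_ne_zero (n : ℤ) (k : ℕ+) : besselJ (n.natAbs + 1) (jz n k) ≠ 0 :=
  besselJ_succ_ne_zero _ (jz_pos n k) (besselJ_jz n k)

/-! ### Integration over the disk in polar coordinates -/

instance isFiniteMeasure_diskMeasure : IsFiniteMeasure diskMeasure :=
  ⟨by rw [diskMeasure, Measure.restrict_apply_univ]; exact measure_ball_lt_top⟩

/-- Fubini in polar coordinates. -/
theorem integral_diskMeasure_eq_polar {f : ℂ → ℂ} (hm : Measurable f)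
    (hf : Integrable f diskMeasure) :
    ∫ z, f z ∂diskMeasure = ∫ r in (0 : ℝ)..1, (r : ℂ) *
      ∫ θ in (-Real.pi)..Real.pi, f (r * Complex.exp (θ * Complex.I)) := by
  have hpi := Real.pi_pos
  have hsymm (p : ℝ × ℝ) : Complex.polarCoord.symm p = p.1 * Complex.exp (p.2 * Complex.I) := by
    rw [Complex.polarCoord_symm_apply, Complex.exp_mul_I]
    push_cast
    ring
  have hball : MeasurableSet (Metric.ball (0 : ℂ) 1) := Metric.isOpen_ball.measurableSet
  set S : Set (ℝ × ℝ) := Set.Ioo 0 1 ×ˢ Set.Ioo (-Real.pi) Real.pi with hS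
  have hST : S ⊆ polarCoord.target := Set.prod_mono (fun x hx => hx.1) subset_rfl
  have hSm : MeasurableSet S := measurableSet_Ioo.prod measurableSet_Ioo
  have hmem (p : ℝ × ℝ) (hp : p ∈ polarCoord.target) :
      Complex.polarCoord.symm p ∈ Metric.ball (0 : ℂ) 1 ↔ p ∈ S := by
    have h1 : 0 < p.1 := hp.1
    rw [mem_ball_zero_iff, Complex.norm_polarCoord_symm, abs_of_pos h1]
    exact ⟨fun h => ⟨⟨h1, h⟩, hp.2⟩, fun h => h.1.2⟩
  have hTm : MeasurableSet polarCoord.target := polarCoord.open_target.measurableSet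
  have hgm : Measurable fun p : ℝ × ℝ => (p.1 : ℂ) * f (p.1 * Complex.exp (p.2 * Complex.I)) := by
    fun_prop
  have hint : IntegrableOn (fun p : ℝ × ℝ => (p.1 : ℂ) * f (p.1 * Complex.exp (p.2 * Complex.I)))
      S := by
    refine ⟨hgm.aestronglyMeasurable, ?_⟩
    have h2 := hf.2
    rw [hasFiniteIntegral_iff_enorm, diskMeasure, ← lintegral_indicator hball,
      ← Complex.lintegral_comp_polarCoord_symm] at h2
    rw [hasFiniteIntegral_iff_enorm]
    refine lt_of_le_of_lt (le_of_eq ?_) (lt_of_le_of_lt (lintegral_mono_set hST) h2)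
    refine setLIntegral_congr_fun hSm fun p hp => ?_
    have h1 : 0 < p.1 := hp.1.1
    rw [Set.indicator_of_mem ((hmem p (hST hp)).2 hp), hsymm, enorm_mul, smul_eq_mul]
    congr 1
    rw [← ofReal_norm, Complex.norm_real, Real.norm_of_nonneg h1.le]
  rw [diskMeasure, ← integral_indicator hball, ← Complex.integral_comp_polarCoord_symm]
  have hA : ∫ p in polarCoord.target, p.1 • (Metric.ball (0 : ℂ) 1).indicator f
      (Complex.polarCoord.symm p) = ∫ p in polarCoord.target, S.indicator
        (fun p : ℝ × ℝ => (p.1 : ℂ) * f (p.1 * Complex.exp (p.2 * Complex.I))) p := by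
    refine setIntegral_congr_fun hTm fun p hp => ?_
    by_cases h : p ∈ S
    · rw [Set.indicator_of_mem h, Set.indicator_of_mem ((hmem p hp).2 h), hsymm,
        Complex.real_smul]
    · rw [Set.indicator_of_notMem h, Set.indicator_of_notMem (mt (hmem p hp).1 h), smul_zero]
  rw [hA, setIntegral_indicator hSm, Set.inter_eq_self_of_subset_right hST, hS,
    Measure.volume_eq_prod, setIntegral_prod _ hint, intervalIntegral.integral_of_le zero_le_one,
    integral_Ioc_eq_integral_Ioo]
  refine setIntegral_congr_fun measurableSet_Ioo fun r _ => ?_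
  simp only
  rw [integral_const_mul, intervalIntegral.integral_of_le (by linarith),
    integral_Ioc_eq_integral_Ioo]

theorem integral_exp_int_mul (n : ℤ) :
    ∫ θ in (-Real.pi)..Real.pi, Complex.exp (Complex.I * n * θ) =
      if n = 0 then 2 * (Real.pi : ℂ) else 0 := by
  split_ifs with h
  · simp only [h, Int.cast_zero, mul_zero, zero_mul, Complex.exp_zero,
      intervalIntegral.integral_const, sub_neg_eq_add, Complex.real_smul, mul_one]
    push_cast
    ring
  · have hc : Complex.I * n ≠ 0 := mul_ne_zero Complex.I_ne_zero (by exact_mod_cast h)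
    rw [integral_exp_mul_complex hc, div_eq_zero_iff, sub_eq_zero]
    left
    rw [Complex.exp_eq_exp_iff_exists_int]
    exact ⟨n, by push_cast; ring⟩

/-! ### The Dirichlet eigenfunctions -/

/-- The normalizing constant `1 / (√π J_{|n|+1}(j_{n,k}))` of `e_{n,k}`. -/
noncomputable def eigenConst (n : ℤ) (k : ℕ+) : ℝ :=
  1 / √Real.pi * (1 / besselJ (n.natAbs + 1) (jz n k))

theorem eigenConst_neg (n : ℤ) (k : ℕ+) : eigenConst (-n) k = eigenConst n k := by
  rw [eigenConst, eigenConst, Int.natAbs_neg, jz_neg]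

theorem eigenfn_eq (n : ℤ) (k : ℕ+) (z : ℂ) :
    eigenfn n k z = ((eigenConst n k * besselJ n.natAbs (jz n k * ‖z‖) : ℝ) : ℂ) *
      Complex.exp (Complex.I * n * Complex.arg z) := rfl

theorem conj_eigenfn (n : ℤ) (k : ℕ+) (z : ℂ) : conj (eigenfn n k z) = eigenfn (-n) k z := by
  rw [eigenfn_eq, eigenfn_eq, map_mul, Complex.conj_ofReal, ← Complex.exp_conj, eigenConst_neg,
    Int.natAbs_neg, jz_neg]
  congr 2
  simp

theorem measurable_eigenfn (n : ℤ) (k : ℕ+) : Measurable (eigenfn n k) := by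
  have h1 := (continuous_besselJ n.natAbs).measurable
  have h2 := Complex.measurable_arg
  unfold eigenfn
  fun_prop

theorem eigenfn_polar (n : ℤ) (k : ℕ+) {r θ : ℝ} (hr : 0 < r)
    (hθ : θ ∈ Set.Ioo (-Real.pi) Real.pi) :
    eigenfn n k (r * Complex.exp (θ * Complex.I)) =
      ((eigenConst n k * besselJ n.natAbs (jz n k * r) : ℝ) : ℂ) *
        Complex.exp (Complex.I * n * θ) := by
  rw [eigenfn_eq, norm_mul, Complex.norm_exp_ofReal_mul_I, mul_one, Complex.norm_real,
    Real.norm_of_nonneg hr.le, Complex.exp_mul_I,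
    Complex.arg_mul_cos_add_sin_mul_I hr ⟨hθ.1, hθ.2.le⟩]

theorem memLp_eigenfn (n : ℤ) (k : ℕ+) (p : ENNReal) : MemLp (eigenfn n k) p diskMeasure := by
  obtain ⟨M, hM⟩ := (isCompact_Icc (a := (0 : ℝ)) (b := 1)).exists_bound_of_continuousOn
    (f := fun r => eigenConst n k * besselJ n.natAbs (jz n k * r))
    (Continuous.continuousOn (by fun_prop))
  refine MemLp.of_bound (measurable_eigenfn n k).aestronglyMeasurable M ?_
  rw [diskMeasure]
  filter_upwards [ae_restrict_mem Metric.isOpen_ball.measurableSet] with z hz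
  have h := hM ‖z‖ ⟨norm_nonneg z, (mem_ball_zero_iff.1 hz).le⟩
  rw [eigenfn_eq, norm_mul, Complex.norm_real, show Complex.I * (n : ℂ) * (Complex.arg z : ℂ) =
    ((n * Complex.arg z : ℝ) : ℂ) * Complex.I by push_cast; ring, Complex.norm_exp_ofReal_mul_I,
    mul_one]
  exact h

/-- In polar coordinates a Fourier–Bessel coefficient is a radial integral of angular Fourier
coefficients. -/
theorem fourierBesselCoeff_eq_polar {g : ℂ → ℂ} (hm : Measurable g) (hg : MemLp g 2 diskMeasure)
    (n : ℤ) (k : ℕ+) :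
    fourierBesselCoeff g n k = eigenConst n k * ∫ r in (0 : ℝ)..1,
      ((r * besselJ n.natAbs (jz n k * r) : ℝ) : ℂ) * ∫ θ in (-Real.pi)..Real.pi,
        g (r * Complex.exp (θ * Complex.I)) * Complex.exp (Complex.I * (-n : ℤ) * θ) := by
  have hpi := Real.pi_pos
  simp only [fourierBesselCoeff, conj_eigenfn]
  rw [integral_diskMeasure_eq_polar (f := fun z => g z * eigenfn (-n) k z)
    (hm.mul (measurable_eigenfn _ k)) (hg.integrable_mul (memLp_eigenfn _ k 2)),
    ← intervalIntegral.integral_const_mul]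
  refine intervalIntegral.integral_congr_Ioo_of_le zero_le_one fun r hr => ?_
  rw [← intervalIntegral.integral_const_mul, ← intervalIntegral.integral_const_mul,
    ← intervalIntegral.integral_const_mul]
  refine intervalIntegral.integral_congr_Ioo_of_le (by linarith) fun θ hθ => ?_
  rw [eigenfn_polar (-n) k hr.1 hθ, eigenConst_neg, Int.natAbs_neg, jz_neg]
  push_cast
  ring

/-- Orthonormality of the eigenfunctions in `L²` of the disk. -/
theorem fourierBesselCoeff_eigenfn (n m : ℤ) (k l : ℕ+) :
    fourierBesselCoeff (eigenfn n k) m l = if (n, k) = (m, l) then 1 else 0 := by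
  have hpi := Real.pi_pos
  rw [fourierBesselCoeff_eq_polar (measurable_eigenfn n k) (memLp_eigenfn n k 2)]
  have h1 : ∫ r in (0 : ℝ)..1, ((r * besselJ m.natAbs (jz m l * r) : ℝ) : ℂ) *
      ∫ θ in (-Real.pi)..Real.pi, eigenfn n k (r * Complex.exp (θ * Complex.I)) *
        Complex.exp (Complex.I * (-m : ℤ) * θ) =
      ((eigenConst n k * ∫ r in (0 : ℝ)..1,
        r * (besselJ m.natAbs (jz m l * r) * besselJ n.natAbs (jz n k * r)) : ℝ) : ℂ) *
        if n - m = 0 then 2 * (Real.pi : ℂ) else 0 := by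
    rw [← integral_exp_int_mul, ← intervalIntegral.integral_const_mul (eigenConst n k),
      ← intervalIntegral.integral_ofReal, ← intervalIntegral.integral_mul_const]
    refine intervalIntegral.integral_congr_Ioo_of_le zero_le_one fun r hr => ?_
    rw [← intervalIntegral.integral_const_mul, ← intervalIntegral.integral_const_mul]
    refine intervalIntegral.integral_congr_Ioo_of_le (by linarith) fun θ hθ => ?_
    rw [eigenfn_polar n k hr.1 hθ, show Complex.I * ((n - m : ℤ) : ℂ) * (θ : ℂ) =
      Complex.I * n * θ + Complex.I * (-m : ℤ) * θ by push_cast; ring, Complex.exp_add]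
    push_cast
    ring
  rw [h1]
  by_cases hnm : n = m
  · subst hnm
    rw [if_pos (sub_self n)]
    by_cases hkl : k = l
    · subst hkl
      have hJ := besselJ_succ_jz_ne_zero n k
      rw [if_pos rfl, integral_besselJ_mul_self _ (jz_pos n k) (besselJ_jz n k), eigenConst]
      have hs : ((√Real.pi : ℝ) : ℂ) ^ 2 = (Real.pi : ℂ) := by
        exact_mod_cast Real.sq_sqrt hpi.le
      have hs0 : ((√Real.pi : ℝ) : ℂ) ≠ 0 := by
        exact_mod_cast (Real.sqrt_pos.2 hpi).ne'
      have hJ' : ((besselJ (n.natAbs + 1) (jz n k) : ℝ) : ℂ) ≠ 0 := by exact_mod_cast hJ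
      push_cast
      rw [← hs]
      field_simp
    · rw [if_neg (by simpa using hkl), integral_besselJ_mul_besselJ _ (jz_pos n l) (jz_pos n k)
        (fun h => hkl (jz_injective n h).symm) (besselJ_jz n l) (besselJ_jz n k)]
      simp
  · rw [if_neg (fun h => hnm (sub_eq_zero.1 h)), if_neg (fun h => hnm (Prod.ext_iff.1 h).1)]
    simp

/-! ### The logarithm is square integrable -/

theorem measurable_logDist (w : ℂ) : Measurable (logDist w) := by
  unfold logDist
  fun_prop

theorem memLp_logDist (w : ℂ) : MemLp (logDist w) 2 diskMeasure := by
  rw [memLp_two_iff_integrable_sq_norm (measurable_logDist w).aestronglyMeasurable]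
  set R : ℝ := 1 + ‖w‖
  have h1 : Integrable (fun z : ℂ => (Set.Iio R).indicator (fun y => Real.log y ^ 2) ‖z‖) := by
    rw [integrable_fun_norm_addHaar]
    -- `y log² y = 4 (√y log √y)²` is continuous up to `y = 0`
    have h2 : IntegrableOn (fun y : ℝ => 4 * (√y * Real.log √y) ^ 2) (Set.Ioo 0 R) := by
      refine (ContinuousOn.integrableOn_compact isCompact_Icc
        (Continuous.continuousOn ?_)).mono_set Set.Ioo_subset_Icc_self
      have := Real.continuous_mul_log.comp Real.continuous_sqrt
      exact continuous_const.mul (this.pow 2)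
    refine (integrable_indicator_iff measurableSet_Ioi).1 ?_
    refine ((integrable_indicator_iff measurableSet_Ioo).2 h2).congr
      (Eventually.of_forall fun y => ?_)
    by_cases hy : 0 < y
    · by_cases hyR : y < R
      · rw [Set.indicator_of_mem (show y ∈ Set.Ioo 0 R from ⟨hy, hyR⟩),
          Set.indicator_of_mem (Set.mem_Ioi.2 hy)]
        simp only [Complex.finrank_real_complex, Nat.add_one_sub_one, pow_one, smul_eq_mul]
        rw [Set.indicator_of_mem (show y ∈ Set.Iio R from hyR), Real.log_sqrt hy.le, mul_pow,
          Real.sq_sqrt hy.le]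
        ring
      · rw [Set.indicator_of_notMem (fun h => hyR h.2), Set.indicator_of_mem (Set.mem_Ioi.2 hy),
          Set.indicator_of_notMem (show y ∉ Set.Iio R from hyR), smul_zero]
    · rw [Set.indicator_of_notMem (fun h => hy h.1), Set.indicator_of_notMem (mt Set.mem_Ioi.1 hy)]
  have h3 := (h1.comp_sub_right w).integrableOn (s := Metric.ball (0 : ℂ) 1)
  refine IntegrableOn.congr_fun h3 (fun z hz => ?_) Metric.isOpen_ball.measurableSet
  have hz1 : ‖z - w‖ < R :=
    (norm_sub_le z w).trans_lt (add_lt_add_left (mem_ball_zero_iff.1 hz) _)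
  simp only [logDist]
  rw [Set.indicator_of_mem (show ‖z - w‖ ∈ Set.Iio R from hz1), Complex.norm_real,
    Real.norm_eq_abs, sq_abs]

/-! ### Angular Fourier coefficients of the logarithm -/

theorem hasSum_log_norm_one_sub {z : ℂ} (hz : ‖z‖ < 1) :
    HasSum (fun m : ℕ => -(1 / 2 : ℂ) * (z ^ m / m + conj z ^ m / m)) (Real.log ‖1 - z‖ : ℂ) := by
  have h := Complex.hasSum_taylorSeries_neg_log hz
  have h' := Complex.hasSum_conj'.2 h
  simp only [map_div₀, map_pow, Complex.conj_natCast] at h'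
  have e : (Real.log ‖1 - z‖ : ℂ) =
      -(1 / 2 : ℂ) * (-Complex.log (1 - z) + conj (-Complex.log (1 - z))) := by
    rw [Complex.add_conj, Complex.neg_re, Complex.log_re]
    push_cast
    ring
  rw [e]
  exact (h.add h').mul_left _

theorem norm_one_sub_mul_exp_ne_zero {q : ℂ} (hq : ‖q‖ < 1) (θ : ℝ) :
    ‖1 - q * Complex.exp (θ * Complex.I)‖ ≠ 0 := fun h => by
  have h1 : ‖q * Complex.exp (θ * Complex.I)‖ = 1 := by
    rw [← sub_eq_zero.1 (norm_eq_zero.1 h), norm_one]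
  rw [norm_mul, Complex.norm_exp_ofReal_mul_I, mul_one] at h1
  exact hq.ne h1

theorem continuous_log_norm_one_sub_mul_exp {q : ℂ} (hq : ‖q‖ < 1) :
    Continuous fun θ : ℝ => (Real.log ‖1 - q * Complex.exp (θ * Complex.I)‖ : ℂ) := by
  exact Complex.continuous_ofReal.comp
    (Continuous.log (by fun_prop) fun θ => norm_one_sub_mul_exp_ne_zero hq θ)

/-- For `n = 0` the right-hand side is `0`, since `π / 0 = 0`, in accordance with the mean value
property of the harmonic function `log |1 - z|`. -/
theorem integral_log_norm_one_sub_mul_exp {q : ℂ} (hq : ‖q‖ < 1) (n : ℕ) :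
    ∫ θ in (-Real.pi)..Real.pi, (Real.log ‖1 - q * Complex.exp (θ * Complex.I)‖ : ℂ) *
      Complex.exp (Complex.I * (-(n : ℤ) : ℤ) * θ) = -(Real.pi / n * q ^ n) := by
  set F : ℕ → ℝ → ℂ := fun m θ => -(1 / 2 : ℂ) *
    (q ^ m / m * Complex.exp (Complex.I * ((m : ℤ) - n : ℤ) * θ)
      + conj q ^ m / m * Complex.exp (Complex.I * (-(m : ℤ) - n : ℤ) * θ)) with hF
  have hexp (N : ℤ) (θ : ℝ) : ‖Complex.exp (Complex.I * N * θ)‖ = 1 := by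
    rw [show Complex.I * (N : ℂ) * (θ : ℂ) = ((N * θ : ℝ) : ℂ) * Complex.I by push_cast; ring,
      Complex.norm_exp_ofReal_mul_I]
  have hlim (θ : ℝ) : HasSum (fun m => F m θ)
      ((Real.log ‖1 - q * Complex.exp (θ * Complex.I)‖ : ℂ) *
        Complex.exp (Complex.I * (-(n : ℤ) : ℤ) * θ)) := by
    have hz : ‖q * Complex.exp (θ * Complex.I)‖ < 1 := by
      rwa [norm_mul, Complex.norm_exp_ofReal_mul_I, mul_one]
    refine ((hasSum_log_norm_one_sub hz).mul_right _).congr_fun fun m => ?_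
    rw [hF]
    simp only
    rw [show Complex.I * (((m : ℤ) - n : ℤ) : ℂ) * (θ : ℂ) =
        m * (θ * Complex.I) + Complex.I * (-(n : ℤ) : ℤ) * θ by push_cast; ring,
      show Complex.I * ((-(m : ℤ) - n : ℤ) : ℂ) * (θ : ℂ) =
        m * (-(θ * Complex.I)) + Complex.I * (-(n : ℤ) : ℤ) * θ by push_cast; ring,
      Complex.exp_add, Complex.exp_add, Complex.exp_nat_mul, Complex.exp_nat_mul, map_mul,
      ← Complex.exp_conj, map_mul, Complex.conj_ofReal, Complex.conj_I, mul_neg, mul_pow, mul_pow]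
    ring
  have hbound (m : ℕ) (θ : ℝ) : ‖F m θ‖ ≤ ‖q‖ ^ m := by
    have hm : ‖q‖ ^ m / m ≤ ‖q‖ ^ m := by
      rcases m.eq_zero_or_pos with rfl | hm
      · simp
      · exact div_le_self (by positivity) (by exact_mod_cast hm)
    calc ‖F m θ‖ ≤ 1 / 2 * (‖q‖ ^ m / m + ‖q‖ ^ m / m) := by
          rw [hF]
          simp only
          rw [norm_mul]
          refine mul_le_mul (by norm_num) ((norm_add_le _ _).trans (le_of_eq ?_)) (norm_nonneg _)
            (by norm_num)
          rw [norm_mul, norm_mul, hexp, hexp]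
          simp
      _ ≤ ‖q‖ ^ m := by linarith
  have hsum := intervalIntegral.hasSum_integral_of_dominated_convergence (μ := volume)
    (a := -Real.pi) (b := Real.pi) (F := F) (fun m _ => ‖q‖ ^ m)
    (fun m => (by rw [hF]; fun_prop : Continuous (F m)).aestronglyMeasurable)
    (fun m => ae_of_all _ fun θ _ => hbound m θ)
    (ae_of_all _ fun θ _ => summable_geometric_of_lt_one (norm_nonneg q) hq)
    intervalIntegrable_const (ae_of_all _ fun θ _ => hlim θ)
  refine hsum.unique ?_
  have hterm (m : ℕ) : ∫ θ in (-Real.pi)..Real.pi, F m θ =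
      if m = n then -(Real.pi / n * q ^ n : ℂ) else 0 := by
    have hI (N : ℤ) (c : ℂ) : IntervalIntegrable
        (fun θ : ℝ => c * Complex.exp (Complex.I * N * θ)) volume (-Real.pi) Real.pi :=
      Continuous.intervalIntegrable (by fun_prop) _ _
    rw [hF]
    simp only
    rw [intervalIntegral.integral_const_mul, intervalIntegral.integral_add (hI _ _) (hI _ _),
      intervalIntegral.integral_const_mul, intervalIntegral.integral_const_mul,
      integral_exp_int_mul, integral_exp_int_mul]
    rcases m.eq_zero_or_pos with rfl | hm
    · by_cases hn : 0 = n
      · subst hn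
        simp
      · simp [hn]
    · rw [if_neg (show ¬(-(m : ℤ) - n = 0) by omega)]
      by_cases hmn : m = n
      · subst hmn
        rw [if_pos (sub_self _), if_pos rfl]
        ring
      · rw [if_neg (show ¬((m : ℤ) - n = 0) by omega), if_neg hmn]
        ring
  simp only [hterm]
  exact hasSum_ite_eq n _

/-- Angular Fourier coefficients of `log |z - w|` on `|z| = r`, where `|z - w|` factors on that
circle as `c |1 - q e^{iθ}|` with `|q| < 1`. -/
theorem integral_logDist_mul_exp {w q : ℂ} {r c : ℝ} (hc : 0 < c) (hq : ‖q‖ < 1)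
    (h : ∀ θ : ℝ, ‖r * Complex.exp (θ * Complex.I) - w‖ =
      c * ‖1 - q * Complex.exp (θ * Complex.I)‖) (n : ℕ) :
    ∫ θ in (-Real.pi)..Real.pi, logDist w (r * Complex.exp (θ * Complex.I)) *
      Complex.exp (Complex.I * (-(n : ℤ) : ℤ) * θ) =
      (if n = 0 then 2 * (Real.pi : ℂ) * Real.log c else 0) - Real.pi / n * q ^ n := by
  have hlog (θ : ℝ) : logDist w (r * Complex.exp (θ * Complex.I)) *
      Complex.exp (Complex.I * (-(n : ℤ) : ℤ) * θ) =
      (Real.log c : ℂ) * Complex.exp (Complex.I * (-(n : ℤ) : ℤ) * θ) +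
      (Real.log ‖1 - q * Complex.exp (θ * Complex.I)‖ : ℂ) *
        Complex.exp (Complex.I * (-(n : ℤ) : ℤ) * θ) := by
    rw [logDist, h, Real.log_mul hc.ne' (norm_one_sub_mul_exp_ne_zero hq θ), Complex.ofReal_add,
      add_mul]
  have hcont := continuous_log_norm_one_sub_mul_exp hq
  simp only [hlog]
  rw [intervalIntegral.integral_add (Continuous.intervalIntegrable (by fun_prop) _ _)
    (Continuous.intervalIntegrable (by fun_prop) _ _), intervalIntegral.integral_const_mul,
    integral_exp_int_mul, integral_log_norm_one_sub_mul_exp hq]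
  by_cases hn : n = 0
  · subst hn
    simp
    ring
  · rw [if_neg (by omega), if_neg hn]
    ring

theorem integral_logDist_mul_exp_of_lt {w : ℂ} {r : ℝ} (hr : 0 ≤ r) (hrw : r < ‖w‖) (n : ℕ) :
    ∫ θ in (-Real.pi)..Real.pi, logDist w (r * Complex.exp (θ * Complex.I)) *
      Complex.exp (Complex.I * (-(n : ℤ) : ℤ) * θ) =
      (if n = 0 then 2 * (Real.pi : ℂ) * Real.log ‖w‖ else 0) - Real.pi / n * (r / w) ^ n := by
  have hw : 0 < ‖w‖ := hr.trans_lt hrw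
  have hw0 : w ≠ 0 := norm_pos_iff.1 hw
  refine integral_logDist_mul_exp hw ?_ (fun θ => ?_) n
  · rw [norm_div, Complex.norm_real, Real.norm_of_nonneg hr]
    exact (div_lt_one hw).2 hrw
  · rw [← norm_mul, ← norm_neg]
    congr 1
    field_simp
    ring

theorem integral_logDist_mul_exp_of_gt {w : ℂ} {r : ℝ} (hrw : ‖w‖ < r) (n : ℕ) :
    ∫ θ in (-Real.pi)..Real.pi, logDist w (r * Complex.exp (θ * Complex.I)) *
      Complex.exp (Complex.I * (-(n : ℤ) : ℤ) * θ) =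
      (if n = 0 then 2 * (Real.pi : ℂ) * Real.log r else 0) - Real.pi / n * (conj w / r) ^ n := by
  have hr : 0 < r := (norm_nonneg w).trans_lt hrw
  have hr0 : (r : ℂ) ≠ 0 := by exact_mod_cast hr.ne'
  refine integral_logDist_mul_exp hr ?_ (fun θ => ?_) n
  · rw [norm_div, Complex.norm_conj, Complex.norm_real, Real.norm_of_nonneg hr.le]
    exact (div_lt_one hr).2 hrw
  · -- `|r - w e^{-iθ}|` is the modulus of the conjugate `r - w̄ e^{iθ}`
    have e1 : (r : ℂ) * Complex.exp (θ * Complex.I) - w = Complex.exp (θ * Complex.I) *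
        conj ((r : ℂ) * (1 - conj w / r * Complex.exp (θ * Complex.I))) := by
      rw [mul_sub, mul_one, ← mul_assoc, mul_div_cancel₀ _ hr0, map_sub, map_mul,
        Complex.conj_ofReal, Complex.conj_conj, ← Complex.exp_conj, map_mul, Complex.conj_ofReal,
        Complex.conj_I, mul_neg, Complex.exp_neg]
      field_simp [Complex.exp_ne_zero]
    rw [e1, norm_mul, Complex.norm_exp_ofReal_mul_I, one_mul, Complex.norm_conj, norm_mul,
      Complex.norm_real, Real.norm_of_nonneg hr.le]

/-! ### Radial integrals -/

theorem integral_pow_mul_besselJ (n : ℕ) {j : ℝ} (hj : 0 < j) {b : ℝ} :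
    ∫ r in (0 : ℝ)..b, r ^ (n + 1) * besselJ n (j * r) =
      b ^ (n + 1) * besselJ (n + 1) (j * b) / j := by
  rw [intervalIntegral.integral_eq_sub_of_hasDerivAt (f := fun r =>
    r ^ (n + 1) * besselJ (n + 1) (j * r) / j) ?_ (Continuous.intervalIntegrable (by fun_prop) _ _)]
  · simp
  · intro r _
    have lin : HasDerivAt (fun r => j * r) j r := by simpa using (hasDerivAt_id r).const_mul j
    have h := ((hasDerivAt_pow_mul_besselJ n (j * r)).comp r lin).div_const (j ^ (n + 2))
    refine (h.congr_deriv ?_).congr_of_eventuallyEq (Eventually.of_forall fun y => ?_)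
    · rw [mul_pow, pow_succ j (n + 1)]
      field_simp
    · simp only [Function.comp, mul_pow]
      rw [pow_succ j (n + 1)]
      field_simp

theorem integral_mul_besselAux (n : ℕ) {j : ℝ} (hj : 0 < j) (a b : ℝ) :
    ∫ r in a..b, r * besselAux (n + 1) ((j * r) ^ 2 / 4) =
      2 / j ^ 2 * (besselAux n ((j * a) ^ 2 / 4) - besselAux n ((j * b) ^ 2 / 4)) := by
  have := continuous_besselAux (n + 1)
  rw [intervalIntegral.integral_eq_sub_of_hasDerivAt (f := fun r =>
    -(2 / j ^ 2) * besselAux n ((j * r) ^ 2 / 4)) ?_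
    (Continuous.intervalIntegrable (by fun_prop) _ _)]
  · ring
  · intro r _
    have lin : HasDerivAt (fun r => j * r) j r := by simpa using (hasDerivAt_id r).const_mul j
    refine (((hasDerivAt_besselAux_sq n (j * r)).comp r lin).const_mul _).congr_deriv ?_
    field_simp

theorem integral_mul_log_mul_besselJ_zero {j : ℝ} (hj : 0 < j) (hJ : besselJ 0 j = 0) {a : ℝ}
    (ha : 0 ≤ a) (ha1 : a ≤ 1) :
    ∫ r in a..1, r * Real.log r * besselJ 0 (j * r) =
      -(besselJ 0 (j * a) / j ^ 2) - a * Real.log a * besselJ 1 (j * a) / j := by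
  have hlog := Real.continuous_mul_log
  rw [intervalIntegral.integral_eq_sub_of_hasDerivAt_of_le (f := fun r =>
    r * Real.log r * besselJ 1 (j * r) / j + besselJ 0 (j * r) / j ^ 2) ha1
    (Continuous.continuousOn (by fun_prop)) ?_ (Continuous.intervalIntegrable (by fun_prop) _ _)]
  · simp [hJ]
    ring
  · intro r hr
    have hr0 : r ≠ 0 := (ha.trans_lt hr.1).ne'
    have lin : HasDerivAt (fun r => j * r) j r := by simpa using (hasDerivAt_id r).const_mul j
    have h1 := (hasDerivAt_besselJ_succ 0 (mul_ne_zero hj.ne' hr0)).comp r lin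
    have h0 := (hasDerivAt_besselJ_zero (j * r)).comp r lin
    refine ((((Real.hasDerivAt_mul_log hr0).fun_mul h1).div_const j).fun_add
      (h0.div_const (j ^ 2))).congr_deriv ?_
    simp only [Function.comp, Nat.cast_zero, zero_add]
    field_simp
    ring

/-! ### The Fourier–Bessel coefficients of the logarithm -/

/-- The form of the eigenfunction used for the coefficients: `r^n e^{-inφ}` is the `n`-th power of
`conj z`. -/
theorem eigenfn_neg_natCast (n : ℕ) (k : ℕ+) (z : ℂ) :
    eigenfn (-(n : ℤ)) k z = eigenConst n k * (((jz n k / 2) ^ n : ℝ) : ℂ) * conj z ^ n *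
      (besselAux n ((jz n k * ‖z‖) ^ 2 / 4) : ℝ) := by
  have hz : conj z = ‖z‖ * Complex.exp (-(Complex.arg z * Complex.I)) := by
    conv_lhs => rw [← Complex.norm_mul_exp_arg_mul_I z]
    rw [map_mul, Complex.conj_ofReal, ← Complex.exp_conj, map_mul, Complex.conj_ofReal,
      Complex.conj_I, mul_neg]
  rw [eigenfn_eq, eigenConst_neg, jz_neg, Int.natAbs_neg, Int.natAbs_natCast, besselJ_eq, hz,
    mul_pow (‖z‖ : ℂ), ← Complex.exp_nat_mul,
    show Complex.I * ((-(n : ℤ) : ℤ) : ℂ) * (Complex.arg z : ℂ) =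
      n * -(Complex.arg z * Complex.I) by push_cast; ring]
  push_cast
  ring

theorem integral_eq_of_eqOn_pieces {G g₁ g₂ : ℝ → ℂ} {a : ℝ} (h0 : 0 ≤ a) (h1 : a ≤ 1)
    (hc₁ : Continuous g₁) (hc₂ : Continuous g₂) (he₁ : Set.EqOn G g₁ (Set.Ioo 0 a))
    (he₂ : Set.EqOn G g₂ (Set.Ioo a 1)) :
    ∫ r in (0 : ℝ)..1, G r = (∫ r in (0 : ℝ)..a, g₁ r) + ∫ r in a..1, g₂ r := by
  rw [← intervalIntegral.integral_congr_Ioo_of_le h0 he₁,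
    ← intervalIntegral.integral_congr_Ioo_of_le h1 he₂,
    intervalIntegral.integral_add_adjacent_intervals]
  · exact (hc₁.intervalIntegrable _ _).congr_uIoo (by rw [Set.uIoo_of_le h0]; exact he₁.symm)
  · exact (hc₂.intervalIntegrable _ _).congr_uIoo (by rw [Set.uIoo_of_le h1]; exact he₂.symm)

theorem eigenConst_mul_besselJ (n : ℤ) (k : ℕ+) :
    (eigenConst n k : ℂ) * (besselJ (n.natAbs + 1) (jz n k) : ℝ) * Real.pi = (√Real.pi : ℝ) := by
  have hJ := besselJ_succ_jz_ne_zero n k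
  have hs := (Real.sqrt_pos.2 Real.pi_pos).ne'
  rw [eigenConst, ← Complex.ofReal_mul, ← Complex.ofReal_mul]
  congr 1
  field_simp
  exact (Real.sq_sqrt Real.pi_pos.le).symm

/-- For `n = 0` the last term is `0`, since `1 / 0 = 0`. -/
theorem fourierBesselCoeff_logDist_of_one_le {w : ℂ} (hw : 1 ≤ ‖w‖) (n : ℕ) (k : ℕ+) :
    fourierBesselCoeff (logDist w) n k = 2 * (√Real.pi : ℝ) / (jz n k : ℂ) *
      ((if n = 0 then (Real.log ‖w‖ : ℂ) else 0) - 1 / (2 * n * w ^ n)) := by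
  have hj := jz_pos n k
  have hj0 : (jz n k : ℂ) ≠ 0 := by exact_mod_cast hj.ne'
  rw [fourierBesselCoeff_eq_polar (measurable_logDist w) (memLp_logDist w)]
  have h1 : ∫ r in (0 : ℝ)..1, ((r * besselJ (n : ℤ).natAbs (jz n k * r) : ℝ) : ℂ) *
      ∫ θ in (-Real.pi)..Real.pi, logDist w (r * Complex.exp (θ * Complex.I)) *
        Complex.exp (Complex.I * (-(n : ℤ) : ℤ) * θ) =
      ((if n = 0 then 2 * (Real.pi : ℂ) * Real.log ‖w‖ else 0) - Real.pi / n * (1 / w ^ n)) *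
        ((∫ r in (0 : ℝ)..1, r ^ (n + 1) * besselJ n (jz n k * r) : ℝ) : ℂ) := by
    rw [← intervalIntegral.integral_ofReal, ← intervalIntegral.integral_const_mul]
    refine intervalIntegral.integral_congr_Ioo_of_le zero_le_one fun r hr => ?_
    rw [integral_logDist_mul_exp_of_lt hr.1.le (hr.2.trans_le hw), Int.natAbs_natCast]
    by_cases hn : n = 0
    · subst hn
      simp
      ring
    · rw [if_neg hn, div_pow]
      push_cast
      ring
  have hC := eigenConst_mul_besselJ n k
  rw [Int.natAbs_natCast] at hC
  rw [h1, integral_pow_mul_besselJ n hj, ← hC]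
  by_cases hn : n = 0
  · subst hn
    simp
    field_simp
  · rw [if_neg hn, if_neg hn]
    push_cast
    simp
    field_simp

theorem fourierBesselCoeff_logDist_zero {w : ℂ} (hw : ‖w‖ < 1) (k : ℕ+) :
    fourierBesselCoeff (logDist w) 0 k =
      -(2 * (Real.pi : ℂ) / (jz 0 k : ℂ) ^ 2) * eigenfn 0 k w := by
  have hj := jz_pos 0 k
  have hJ : besselJ 0 (jz 0 k) = 0 := besselJ_jz 0 k
  have hlog := Real.continuous_mul_log
  rw [fourierBesselCoeff_eq_polar (measurable_logDist w) (memLp_logDist w)]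
  rw [integral_eq_of_eqOn_pieces (norm_nonneg w) hw.le
    (g₁ := fun r => 2 * (Real.pi : ℂ) * Real.log ‖w‖ *
      ((r ^ (0 + 1) * besselJ 0 (jz 0 k * r) : ℝ) : ℂ))
    (g₂ := fun r => 2 * (Real.pi : ℂ) * ((r * Real.log r * besselJ 0 (jz 0 k * r) : ℝ) : ℂ))
    (by fun_prop) (by fun_prop) (fun r hr => ?_) (fun r hr => ?_)]
  · rw [intervalIntegral.integral_const_mul, intervalIntegral.integral_const_mul,
      intervalIntegral.integral_ofReal, intervalIntegral.integral_ofReal,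
      integral_pow_mul_besselJ 0 hj, integral_mul_log_mul_besselJ_zero hj hJ (norm_nonneg w) hw.le,
      eigenfn_eq]
    simp
    ring
  · have h := integral_logDist_mul_exp_of_lt hr.1.le hr.2 0
    simp only [Nat.cast_zero] at h ⊢
    rw [h]
    simp
    ring
  · have h := integral_logDist_mul_exp_of_gt hr.1 0
    simp only [Nat.cast_zero] at h ⊢
    rw [h]
    simp
    ring

/-- On `|w| < r < 1` the factor `r^{1-n} J_n(jr)` of the radial integrand is written as a multiple
of `r h_n((jr)²/4)`, which is regular at `r = 0`, so that `w = 0` needs no separate limit. -/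
theorem fourierBesselCoeff_logDist_of_lt_one {w : ℂ} (hw : ‖w‖ < 1) {n : ℕ} (hn : n ≠ 0)
    (k : ℕ+) :
    fourierBesselCoeff (logDist w) n k =
      -(2 * (Real.pi : ℂ) / (jz n k : ℂ) ^ 2) * eigenfn (-(n : ℤ)) k w
        - (√Real.pi : ℝ) * conj w ^ n / ((jz n k : ℂ) * n) := by
  obtain ⟨m, hm⟩ := Nat.exists_eq_succ_of_ne_zero hn
  have hj := jz_pos n k
  have hJ : besselJ n (jz n k) = 0 := besselJ_jz n k
  have hn0 : (n : ℂ) ≠ 0 := by exact_mod_cast hn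
  have haux := continuous_besselAux n
  have hC := eigenConst_mul_besselJ n k
  rw [Int.natAbs_natCast, besselJ_eq (n + 1)] at hC
  have hrad := fun a b : ℝ => integral_mul_besselAux m hj a b
  have hrec := besselAux_rec m
  rw [show m + 2 = n + 1 by omega, show (m : ℝ) + 1 = n by rw [hm]; push_cast; ring,
    show m + 1 = n from hm.symm] at hrec
  rw [show m + 1 = n from hm.symm] at hrad
  rw [fourierBesselCoeff_eq_polar (measurable_logDist w) (memLp_logDist w)]
  rw [integral_eq_of_eqOn_pieces (norm_nonneg w) hw.le
    (g₁ := fun r => -(Real.pi / n * (1 / w ^ n) : ℂ) *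
      ((r ^ (n + 1) * besselJ n (jz n k * r) : ℝ) : ℂ))
    (g₂ := fun r => -(Real.pi / n * conj w ^ n * ((jz n k / 2) ^ n : ℝ) : ℂ) *
      ((r * besselAux n ((jz n k * r) ^ 2 / 4) : ℝ) : ℂ))
    (by fun_prop) (by fun_prop) (fun r hr => ?_) (fun r hr => ?_)]
  · rw [intervalIntegral.integral_const_mul, intervalIntegral.integral_const_mul,
      intervalIntegral.integral_ofReal, intervalIntegral.integral_ofReal,
      integral_pow_mul_besselJ n hj, hrad, eigenfn_neg_natCast, ← hC]
    generalize jz n k = j at hj hJ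
    generalize eigenConst n k = C
    have hj0 : (j : ℂ) ≠ 0 := by exact_mod_cast hj.ne'
    have hA1 : besselAux n (j ^ 2 / 4) = 0 := by
      rw [besselJ_eq] at hJ
      exact (mul_eq_zero.1 hJ).resolve_left (by positivity)
    have hw1 : 1 / w ^ n * ((‖w‖ ^ (n + 1) * besselJ (n + 1) (j * ‖w‖) / j : ℝ) : ℂ) =
        conj w ^ n * (‖w‖ ^ 2 / 2 * (j / 2) ^ n *
          besselAux (n + 1) ((j * ‖w‖) ^ 2 / 4) : ℝ) := by
      by_cases hw0 : w = 0
      · simp [hw0, hn]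
      · have e : w ^ n * conj w ^ n = ((‖w‖ ^ 2) ^ n : ℝ) := by
          rw [← mul_pow, Complex.mul_conj, Complex.normSq_eq_norm_sq, ← Complex.ofReal_pow]
        rw [besselJ_eq, one_div, inv_mul_eq_iff_eq_mul₀ (pow_ne_zero _ hw0), ← mul_assoc (w ^ n), e,
          ← Complex.ofReal_mul]
        congr 1
        field_simp
        ring
    -- the terms with `h_{n+1}((j|w|)²/4)` from the two pieces cancel by the recurrence
    rw [neg_mul, mul_assoc (Real.pi / n : ℂ), hw1, mul_one, hrec, hrec, hA1]
    push_cast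
    field_simp
    ring
  · simp only
    rw [integral_logDist_mul_exp_of_lt hr.1.le hr.2 n, Int.natAbs_natCast, if_neg hn, div_pow]
    push_cast
    ring
  · have hr0 : (r : ℂ) ≠ 0 := by exact_mod_cast ((norm_nonneg w).trans_lt hr.1).ne'
    simp only
    rw [integral_logDist_mul_exp_of_gt hr.1 n, Int.natAbs_natCast, if_neg hn, besselJ_eq,
      mul_div_right_comm, mul_pow, div_pow (conj w)]
    push_cast
    field_simp
    ring

theorem fourierBesselCoeff_logDist_neg (w : ℂ) (n : ℤ) (k : ℕ+) :
    fourierBesselCoeff (logDist w) (-n) k = conj (fourierBesselCoeff (logDist w) n k) := by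
  rw [fourierBesselCoeff, fourierBesselCoeff, ← integral_conj]
  refine integral_congr_ae (ae_of_all _ fun z => ?_)
  simp only [map_mul, conj_eigenfn, neg_neg, logDist, Complex.conj_ofReal]

/-! ### Fourier–Bessel series in `L²` of the disk -/

/-- The eigenfunction `e_{n,k}` as an element of the Hilbert space `L²` of the disk. -/
noncomputable def eigenLp (p : ℤ × ℕ+) : Lp ℂ 2 diskMeasure :=
  (memLp_eigenfn p.1 p.2 2).toLp (eigenfn p.1 p.2)

theorem inner_eigenLp_toLp {g : ℂ → ℂ} (hg : MemLp g 2 diskMeasure) (p : ℤ × ℕ+) :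
    inner ℂ (eigenLp p) (hg.toLp g) = fourierBesselCoeff g p.1 p.2 := by
  rw [L2.inner_def, fourierBesselCoeff]
  refine integral_congr_ae ?_
  filter_upwards [hg.coeFn_toLp, (memLp_eigenfn p.1 p.2 2).coeFn_toLp] with z h1 h2
  rw [eigenLp, h1, h2, RCLike.inner_apply]

theorem orthonormal_eigenLp : Orthonormal ℂ eigenLp := by
  classical
  rw [orthonormal_iff_ite]
  intro p q
  rw [eigenLp.eq_def q, inner_eigenLp_toLp, fourierBesselCoeff_eigenfn]
  exact if_congr eq_comm rfl rfl

theorem memLp_partialSum (a : ℤ × ℕ+ → ℂ) (F : Finset (ℤ × ℕ+)) :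
    MemLp (partialSum a F) 2 diskMeasure :=
  memLp_finsetSum F fun p _ => (memLp_eigenfn p.1 p.2 2).const_mul (a p)

theorem toLp_partialSum (a : ℤ × ℕ+ → ℂ) (F : Finset (ℤ × ℕ+)) :
    (memLp_partialSum a F).toLp (partialSum a F) = ∑ p ∈ F, a p • eigenLp p := by
  classical
  induction F using Finset.induction_on with
  | empty =>
    have he : partialSum a ∅ = 0 := funext fun z => Finset.sum_empty
    have h0 : MemLp (0 : ℂ → ℂ) 2 diskMeasure := MemLp.zero
    rw [Finset.sum_empty, ← MemLp.toLp_zero h0]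
    exact MemLp.toLp_congr (memLp_partialSum a ∅) h0 (ae_of_all _ fun z => congrFun he z)
  | insert p F hp ih =>
    have he : partialSum a (insert p F) = a p • eigenfn p.1 p.2 + partialSum a F :=
      funext fun z => Finset.sum_insert hp
    have hp2 := (memLp_eigenfn p.1 p.2 2).const_smul (a p)
    rw [Finset.sum_insert hp, ← ih, eigenLp,
      ← MemLp.toLp_const_smul (a p) (memLp_eigenfn p.1 p.2 2),
      ← MemLp.toLp_add hp2 (memLp_partialSum a F)]
    exact MemLp.toLp_congr _ (hp2.add (memLp_partialSum a F)) (ae_of_all _ fun z => congrFun he z)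

theorem isL2Sum_iff_hasSum {a : ℤ × ℕ+ → ℂ} {f : ℂ → ℂ} (hf : MemLp f 2 diskMeasure) :
    IsL2Sum a f ↔ HasSum (fun p => a p • eigenLp p) (hf.toLp f) := by
  have h := Lp.tendsto_Lp_iff_tendsto_eLpNorm'' (fi := (atTop : Filter (Finset (ℤ × ℕ+))))
    (partialSum a) (memLp_partialSum a) f hf
  simp only [toLp_partialSum] at h
  rw [HasSum, SummationFilter.unconditional_filter, h]
  refine ⟨fun h' => ?_, fun h' => ⟨hf, ?_⟩⟩
  · exact h'.2.congr fun F => eLpNorm_sub_comm f (partialSum a F) 2 diskMeasure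
  · exact h'.congr fun F => eLpNorm_sub_comm (partialSum a F) f 2 diskMeasure

theorem MemH.summable_norm_sq {s : ℝ} (hs : 0 ≤ s) {a : ℤ × ℕ+ → ℂ} (ha : MemH s a) :
    Summable fun p => ‖a p‖ ^ 2 :=
  Summable.of_nonneg_of_le (fun p => by positivity) (fun p => le_mul_of_one_le_right (by positivity)
    (Real.one_le_rpow (one_lt_jz p.1 p.2).le (by linarith))) ha

theorem exists_isL2Sum {a : ℤ × ℕ+ → ℂ} (ha : Summable fun p => ‖a p‖ ^ 2) :
    ∃ f : ℂ → ℂ, IsL2Sum a f := by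
  have h : Summable fun p => a p • eigenLp p :=
    (orthonormal_eigenLp.orthogonalFamily.summable_iff_norm_sq_summable a).2 ha
  obtain ⟨x, hx⟩ := h
  refine ⟨x, (isL2Sum_iff_hasSum (Lp.memLp x)).2 ?_⟩
  rwa [Lp.toLp_coeFn]

/-- Parseval's identity for the bilinear pairing `∫ g f`; the reflection `n ↦ -n` comes from
`conj e_{n,k} = e_{-n,k}`. -/
theorem IsL2Sum.hasSum_integral_mul {a : ℤ × ℕ+ → ℂ} {f g : ℂ → ℂ} (hf : IsL2Sum a f)
    (hg : MemLp g 2 diskMeasure) :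
    HasSum (fun p : ℤ × ℕ+ => fourierBesselCoeff g p.1 p.2 * a (-p.1, p.2))
      (∫ z, g z * f z ∂diskMeasure) := by
  have hg' : MemLp (fun z => conj (g z)) 2 diskMeasure := hg.star
  have hsum := ((isL2Sum_iff_hasSum hf.1).1 hf).mapL (innerSL ℂ (hg'.toLp _))
  simp only [innerSL_apply_apply, inner_smul_right] at hsum
  have hI : inner ℂ (hg'.toLp _) (hf.1.toLp f) = ∫ z, g z * f z ∂diskMeasure := by
    rw [L2.inner_def]
    refine integral_congr_ae ?_
    filter_upwards [hg'.coeFn_toLp, hf.1.coeFn_toLp] with z h1 h2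
    rw [h1, h2, RCLike.inner_apply, Complex.conj_conj, mul_comm]
  rw [hI] at hsum
  have hc (p : ℤ × ℕ+) : inner ℂ (hg'.toLp _) (eigenLp p) = fourierBesselCoeff g (-p.1) p.2 := by
    rw [← inner_conj_symm, inner_eigenLp_toLp, fourierBesselCoeff, fourierBesselCoeff,
      ← integral_conj]
    refine integral_congr_ae (ae_of_all _ fun z => ?_)
    simp only [map_mul, Complex.conj_conj, conj_eigenfn, neg_neg]
  simp only [hc] at hsum
  rw [← ((Equiv.neg ℤ).prodCongr (Equiv.refl ℕ+)).hasSum_iff] at hsum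
  refine hsum.congr_fun fun p => ?_
  simp only [Function.comp, Equiv.prodCongr_apply, Prod.map, Equiv.neg_apply, Equiv.refl_apply,
    neg_neg]
  exact mul_comm _ _

theorem fourierBesselCoeff_sub_partialSum {g : ℂ → ℂ} (hg : MemLp g 2 diskMeasure)
    (F : Finset (ℤ × ℕ+)) (p : ℤ × ℕ+) :
    fourierBesselCoeff (fun z => g z - partialSum (fun q => fourierBesselCoeff g q.1 q.2) F z)
      p.1 p.2 = (Fᶜ : Set (ℤ × ℕ+)).indicator (fun q => fourierBesselCoeff g q.1 q.2) p := by
  classical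
  set α : ℤ × ℕ+ → ℂ := fun q => fourierBesselCoeff g q.1 q.2
  have h := inner_eigenLp_toLp (hg.sub (memLp_partialSum α F)) p
  rw [MemLp.toLp_sub hg (memLp_partialSum α F), toLp_partialSum, inner_sub_right,
    inner_eigenLp_toLp] at h
  simp only [inner_sum, inner_smul_right, orthonormal_iff_ite.1 orthonormal_eigenLp, mul_ite,
    mul_one, mul_zero, Finset.sum_ite_eq] at h
  refine h.symm.trans ?_
  by_cases hp : p ∈ F
  · rw [if_pos hp, Set.indicator_of_notMem (by simpa using hp), sub_self]
  · rw [if_neg hp, Set.indicator_of_mem (show p ∈ (Fᶜ : Set (ℤ × ℕ+)) from hp), sub_zero]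

/-- The duality between `H^{-s}` and `H^s`. -/
theorem norm_tsum_mul_le {s : ℝ} {b a : ℤ × ℕ+ → ℂ} (hb : MemH (-s) b) (ha : MemH s a) :
    ‖∑' p : ℤ × ℕ+, b p * a (-p.1, p.2)‖ ≤ hNorm (-s) b * hNorm s a := by
  set σ : ℤ × ℕ+ ≃ ℤ × ℕ+ := (Equiv.neg ℤ).prodCongr (Equiv.refl ℕ+)
  have hsq (t : ℝ) (c : ℂ) (p : ℤ × ℕ+) :
      (‖c‖ * jz p.1 p.2 ^ t) ^ (2 : ℝ) = ‖c‖ ^ 2 * jz p.1 p.2 ^ (2 * t) := by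
    rw [Real.rpow_two, mul_pow, ← Real.rpow_mul_natCast (jz_pos _ _).le, mul_comm 2 t]
    rfl
  have ha' : (fun p : ℤ × ℕ+ => ‖a (-p.1, p.2)‖ ^ 2 * jz p.1 p.2 ^ (2 * s)) =
      (fun p => ‖a p‖ ^ 2 * jz p.1 p.2 ^ (2 * s)) ∘ σ :=
    funext fun p => by
      simp only [Function.comp, σ, Equiv.prodCongr_apply, Prod.map, Equiv.neg_apply,
        Equiv.refl_apply, jz_neg]
  have hH := Real.summable_and_inner_le_Lp_mul_Lq_tsum_of_nonneg Real.HolderConjugate.two_two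
    (f := fun p : ℤ × ℕ+ => ‖b p‖ * jz p.1 p.2 ^ (-s))
    (g := fun p : ℤ × ℕ+ => ‖a (-p.1, p.2)‖ * jz p.1 p.2 ^ s)
    (fun p => mul_nonneg (norm_nonneg _) (Real.rpow_nonneg (jz_pos _ _).le _))
    (fun p => mul_nonneg (norm_nonneg _) (Real.rpow_nonneg (jz_pos _ _).le _))
    (by simp only [hsq]; exact hb)
    (by simp only [hsq]; rw [ha']; exact σ.summable_iff.2 ha)
  have hprod (p : ℤ × ℕ+) : ‖b p‖ * jz p.1 p.2 ^ (-s) * (‖a (-p.1, p.2)‖ * jz p.1 p.2 ^ s) =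
      ‖b p * a (-p.1, p.2)‖ := by
    have : jz p.1 p.2 ^ (-s) * jz p.1 p.2 ^ s = 1 := by
      rw [← Real.rpow_add (jz_pos _ _), neg_add_cancel, Real.rpow_zero]
    rw [norm_mul, mul_mul_mul_comm, this, mul_one]
  simp only [hprod, hsq] at hH
  refine (norm_tsum_le_tsum_norm hH.1).trans (hH.2.trans (le_of_eq ?_))
  rw [ha', ← Real.sqrt_eq_rpow, ← Real.sqrt_eq_rpow]
  rw [show ∑' p, ((fun p : ℤ × ℕ+ => ‖a p‖ ^ 2 * jz p.1 p.2 ^ (2 * s)) ∘ σ) p = _ from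
    σ.tsum_eq (fun p => ‖a p‖ ^ 2 * jz p.1 p.2 ^ (2 * s)), hNorm, hNorm]

/-- Every `g ∈ L²` of the disk is, as an element of `H^{-s}`, the sum of its Fourier–Bessel
series. -/
theorem equalsInHNeg_of_memLp {s : ℝ} (hs : 0 < s) {g : ℂ → ℂ} (hg : MemLp g 2 diskMeasure) :
    EqualsInHNeg s g fun p => fourierBesselCoeff g p.1 p.2 := by
  set α : ℤ × ℕ+ → ℂ := fun q => fourierBesselCoeff g q.1 q.2 with hα
  have hα2 : Summable fun p => ‖α p‖ ^ 2 := by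
    have h := orthonormal_eigenLp.inner_products_summable (hg.toLp g)
    simpa only [inner_eigenLp_toLp] using h
  have hmem : MemH (-s) α := Summable.of_nonneg_of_le
    (fun p => mul_nonneg (by positivity) (Real.rpow_nonneg (jz_pos p.1 p.2).le _))
    (fun p => mul_le_of_le_one_right (by positivity)
      (Real.rpow_le_one_of_one_le_of_nonpos (one_lt_jz p.1 p.2).le (by linarith))) hα2
  refine ⟨hmem, fun a ha => exists_isL2Sum (ha.summable_norm_sq hs.le),
    fun a f ha hf => ⟨hg.integrable_mul hf.1, hf.hasSum_integral_mul hg⟩, fun ε hε => ?_⟩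
  have htail := tendsto_tsum_compl_atTop_zero
    fun p : ℤ × ℕ+ => ‖α p‖ ^ 2 * jz p.1 p.2 ^ (2 * -s)
  filter_upwards [htail.eventually_lt_const (show 0 < ε ^ 2 by positivity)] with F hF a f ha hf
  have hind : (fun p => ‖(Fᶜ : Set (ℤ × ℕ+)).indicator α p‖ ^ 2 * jz p.1 p.2 ^ (2 * -s)) =
      (Fᶜ : Set (ℤ × ℕ+)).indicator (fun p => ‖α p‖ ^ 2 * jz p.1 p.2 ^ (2 * -s)) := by
    funext p
    by_cases hp : p ∈ (Fᶜ : Set (ℤ × ℕ+))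
    · rw [Set.indicator_of_mem hp, Set.indicator_of_mem hp]
    · rw [Set.indicator_of_notMem hp, Set.indicator_of_notMem hp]
      simp
  have hmemF : MemH (-s) ((Fᶜ : Set (ℤ × ℕ+)).indicator α) := by
    rw [MemH, hind]
    exact hmem.indicator _
  have hsmall : hNorm (-s) ((Fᶜ : Set (ℤ × ℕ+)).indicator α) ≤ ε := by
    rw [hNorm, hind, ← tsum_subtype]
    exact Real.sqrt_le_iff.2 ⟨hε.le, hF.le⟩
  have hsum := (hf.hasSum_integral_mul (hg.sub (memLp_partialSum α F))).tsum_eq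
  have hcoef := fourierBesselCoeff_sub_partialSum hg F
  have hcongr : ∑' p : ℤ × ℕ+, fourierBesselCoeff (g - partialSum α F) p.1 p.2 * a (-p.1, p.2) =
      ∑' p : ℤ × ℕ+, (Fᶜ : Set (ℤ × ℕ+)).indicator α p * a (-p.1, p.2) :=
    tsum_congr fun p => congrArg (· * a (-p.1, p.2)) (hcoef p)
  calc ‖∫ z, (g z - partialSum α F z) * f z ∂diskMeasure‖
      = ‖∑' p : ℤ × ℕ+, (Fᶜ : Set (ℤ × ℕ+)).indicator α p * a (-p.1, p.2)‖ := by
        rw [← hcongr, hsum]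
        rfl
    _ ≤ hNorm (-s) ((Fᶜ : Set (ℤ × ℕ+)).indicator α) * hNorm s a := norm_tsum_mul_le hmemF ha
    _ ≤ ε * hNorm s a := mul_le_mul_of_nonneg_right hsmall (Real.sqrt_nonneg _)

/-! ### The expansion of the logarithm -/

theorem mainTheorem6 (s : ℝ) (hs : 0 < s) (w : ℂ) :
    MemLp (logDist w) 2 diskMeasure ∧
    EqualsInHNeg s (logDist w) (fun p => fourierBesselCoeff (logDist w) p.1 p.2) ∧
    (‖w‖ < 1 → ∀ (n : ℤ) (k : ℕ+),
      fourierBesselCoeff (logDist w) n k =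
        -(2 * (Real.pi : ℂ) / (jz n k : ℂ) ^ 2) * eigenfn (-n) k w
          - (if 0 < n then (√Real.pi : ℂ) * conj w ^ n / ((jz n k : ℂ) * (|n| : ℤ)) else 0)
          - (if n < 0 then (√Real.pi : ℂ) * w ^ (-n) / ((jz n k : ℂ) * (|n| : ℤ)) else 0)) ∧
    (1 ≤ ‖w‖ → ∀ (n : ℤ) (k : ℕ+),
      fourierBesselCoeff (logDist w) n k =
        2 * (√Real.pi : ℂ) / (jz n k : ℂ) *
          ((if n = 0 then (Real.log ‖w‖ : ℂ) else 0)
            - (if 0 < n then 1 / (2 * (n : ℂ) * w ^ n) else 0)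
            - (if n < 0 then 1 / (2 * ((|n| : ℤ) : ℂ) * conj w ^ |n|) else 0))) := by
  refine ⟨memLp_logDist w, equalsInHNeg_of_memLp hs (memLp_logDist w), fun hw n k => ?_,
    fun hw n k => ?_⟩
  · obtain ⟨m, rfl | rfl⟩ := n.eq_nat_or_neg
    · rcases eq_or_ne m 0 with rfl | hm
      · simpa using fourierBesselCoeff_logDist_zero hw k
      · rw [if_pos (by omega), if_neg (by omega), sub_zero, Nat.abs_cast, zpow_natCast,
          fourierBesselCoeff_logDist_of_lt_one hw hm]
        rfl
    · rcases eq_or_ne m 0 with rfl | hm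
      · simpa using fourierBesselCoeff_logDist_zero hw k
      · rw [if_neg (by omega), if_pos (by omega), sub_zero, abs_neg, Nat.abs_cast, neg_neg,
          zpow_natCast, fourierBesselCoeff_logDist_neg, jz_neg,
          fourierBesselCoeff_logDist_of_lt_one hw hm]
        simp [conj_eigenfn, Complex.conj_ofNat]
  · obtain ⟨m, rfl | rfl⟩ := n.eq_nat_or_neg
    · rw [fourierBesselCoeff_logDist_of_one_le hw]
      rcases eq_or_ne m 0 with rfl | hm
      · simp
      · rw [if_neg hm, if_neg (by omega), if_pos (by omega), if_neg (by omega), sub_zero,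
          zpow_natCast]
        simp
    · rw [fourierBesselCoeff_logDist_neg, fourierBesselCoeff_logDist_of_one_le hw, jz_neg]
      rcases eq_or_ne m 0 with rfl | hm
      · simp [Complex.conj_ofNat]
      · rw [if_neg hm, if_neg (by omega), if_neg (by omega), if_pos (by omega), sub_zero, abs_neg,
          Nat.abs_cast, zpow_natCast]
        simp [Complex.conj_ofNat]
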